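/- Let $P$ be a transition probability kernel on $\mathbf R$ and let $X=(X_n)_{n\ge0}$ be a time-homogeneous Markov chain with transition kernel $P$, an arbitrary initial distribution, and state space $S$, where $S=\mathbf R$ or $S=\mathbf Z$. For $x\in S$ let $\xi(x)$ be a random variable distributed as the jump of the chain at $x$, that is, $\mathbf P\{x+\xi(x)\in B\}=P(x,B)$ for all Borel sets $B$. Let $Q=\sum_{n\ge0}P^n$ be the renewal kernel and $U(B)=\sum_{n\ge0}\mathbf P\{X_n\in B\}$ the renewal measure. Assume that the chain is transient in the sense that $$\sup_{y\in S}Q(y,(k,k+1])<\infty\quad\text{for every }k\in\mathbf Z .$$ Suppose that $\xi(x)$ converges weakly, as $x\to\infty$ in $S$, to a random variable $\xi$ with distribution $F$ and $\mathbf E\xi>0$; that there is a random variable $\eta$ with $\mathbf E\eta<\infty$ and $\mathbf P\{|\xi(x)|>t\}\le\mathbf P\{\eta>t\}$ for all $x\in S$ and $t\in\mathbf R$; that $$\sup_{k\in\mathbf Z}U(k,k+1]<\infty ;$$ and that the limit $p_0=\lim_{n\to\infty}\mathbf P\{X_n>0\}$ exists. (i) If $F$ is non-lattice (that is, not concentrated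 on $\{ka:k\in\mathbf Z\}$ for any $a>0$), then for every fixed $h>0$ $$U(x,x+h]\to\frac{p_0\,h}{\mathbf E\xi}\quad\text{as }x\to\infty .$$ (ii) If the chain is integer valued and $F$ is lattice with span $1$ (that is, $F$ is concentrated on $\mathbf Z$ and on no lattice $\{ka:k\in\mathbf Z\}$ with $a>1$), then $$U\{n\}\to\frac{p_0}{\mathbf E\xi}\quad\text{as }n\to\infty .$$ -/

import Mathlib

open MeasureTheory ProbabilityTheory Set Filter Topology

noncomputable section

/-- `X` is a time-homogeneous Markov chain on `ℝ` with transition kernel `P`, under the probability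
measure `μ`: given the whole past `X 0, …, X n`, the next value `X (n + 1)` has
law `P (X n)`. The initial law is the law of `X 0` and is arbitrary. -/
structure IsMarkovChain {Ω : Type*} [MeasurableSpace Ω] (μ : Measure Ω) (P : Kernel ℝ ℝ)
    (X : ℕ → Ω → ℝ) : Prop where
  measurable : ∀ n, Measurable (X n)
  markov : ∀ n, ∀ B : Set ℝ, MeasurableSet B →
    μ⟦X (n + 1) ⁻¹' B | MeasurableSpace.comap (fun ω (i : Fin (n + 1)) => X i ω) inferInstance⟧
      =ᵐ[μ] fun ω => (P (X n ω)).real B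

/-- The law of the jump `ξ(x)` of the chain at the state `x`, where `x + ξ(x)` has law `P x`. -/
def jumpLaw (P : Kernel ℝ ℝ) [IsMarkovKernel P] (x : ℝ) : ProbabilityMeasure ℝ :=
  ⟨(P x).map (fun y => y - x), Measure.isProbabilityMeasure_map (by fun_prop)⟩

/-- The renewal (potential) kernel `Q = ∑ₙ Pⁿ`; the powers are for composition of kernels. -/
def renewalKernel (P : Kernel ℝ ℝ) : Kernel ℝ ℝ := Kernel.sum fun n : ℕ => P ^ n

/-- The renewal measure `U(B) = ∑ₙ μ{X n ∈ B}` of the process `X`. -/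
def renewalMeasure {Ω : Type*} [MeasurableSpace Ω] (μ : Measure Ω) (X : ℕ → Ω → ℝ) : Measure ℝ :=
  Measure.sum fun n : ℕ => μ.map (X n)

/-- `F` is concentrated on the lattice `{k a : k ∈ ℤ}`. -/
def ConcentratedOnLattice (F : ProbabilityMeasure ℝ) (a : ℝ) : Prop :=
  (F : Measure ℝ) {x : ℝ | ∃ k : ℤ, x = k * a} = 1

/-- `F` is lattice: it is concentrated on `{k a : k ∈ ℤ}` for some `a > 0`. -/
def IsLattice (F : ProbabilityMeasure ℝ) : Prop :=
  ∃ a : ℝ, 0 < a ∧ ConcentratedOnLattice F a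

/-- `{k a : k ∈ ℤ}` is the minimal lattice carrying `F`, so that `a` is the span of `F`: no
lattice `{k b : k ∈ ℤ}` with a larger step `b` carries `F`. -/
def HasSpan (F : ProbabilityMeasure ℝ) (a : ℝ) : Prop :=
  0 < a ∧ ConcentratedOnLattice F a ∧ ∀ b : ℝ, 0 < b → ConcentratedOnLattice F b → b ≤ a

end

/-! The proof combines a flux identity with an asymptotic Choquet–Deny argument. Let `f` be a step,
equal to 0 far to the left and to `c` far to the right. Summing the one-step increments of `E f(X n
- x)` over all `n` telescopes to `c * p₀ - E f(X 0 - x)`. As `x → ∞` the initial term vanishes. The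
jump laws can be replaced by `F`, because only states near `x` matter: the majorant makes distant
contributions uniformly summable, and `U` has bounded mass on unit intervals. Hence the integral of
`meanIncrement F f (y - x)` against `U` tends to `c * p₀` (`tendsto_integral_meanIncrement`).

This limit is used twice, for a bump `φ` and for its primitive. Write `G x` for the integral of `φ
(y - x)` against `U`. For `f = φ`, where `c = 0`, it says that `G x` differs from the `F`-mean of `G
(x - z)` by `o(1)`. By `tendsto_sub_of_mem_support`, each point of the support of `F` is then an
asymptotic period of `G`. These periods form a subgroup: it is dense if `F` is non-lattice, and
contains 1 if the span is 1. In both cases all reals turn out to be periods, so `G` varies slowly.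
For the primitive of `φ`, the same limit reads `∫ z, (∫ s in 0..z, G (x - s)) ∂F → p₀ * ∫ φ`. Slow
variation makes the left side asymptotic to the mean of `F` times `G x`, which gives the limit of
`G` (`tendsto_smoothed`).

Intervals are then squeezed between bumps. In the integer case the tent function reads off single
atoms. -/

/-! ### Integration against measures with bounded mass on unit intervals -/

theorem summable_measureReal_lt_abs (J : Measure ℝ) [IsProbabilityMeasure J]
    (hJ : Integrable (fun z : ℝ => z) J) : Summable fun n : ℕ => J.real {z : ℝ | (n : ℝ) < |z|} := by
  have h := @tsum_prob_mem_Ioi_lt_top ℝ ⟨J⟩ ‹_› (fun z => |z|) hJ.abs (fun z => abs_nonneg z)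
  exact ENNReal.summable_toReal h.ne

theorem summable_measureReal_Ioi (J : Measure ℝ) [IsProbabilityMeasure J]
    (hJ : Integrable (fun z : ℝ => z) J) : Summable fun n : ℕ => J.real (Ioi (n : ℝ)) :=
  (summable_measureReal_lt_abs J hJ).of_nonneg_of_le (fun _ => measureReal_nonneg) fun n =>
    measureReal_mono (fun z hz => lt_of_lt_of_le hz (le_abs_self z))

/-- Unit intervals carry uniformly bounded mass as soon as those with integer ends do. -/
theorem measure_Ioc_add_one_le {U : Measure ℝ}
    (hU : (⨆ k : ℤ, U (Ioc (k : ℝ) (k + 1))) < ⊤) :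
    ∃ C : ℝ, 0 ≤ C ∧ ∀ x : ℝ, U (Ioc x (x + 1)) ≤ ENNReal.ofReal C := by
  set s := ⨆ k : ℤ, U (Ioc (k : ℝ) (k + 1)) with hs
  refine ⟨(s + s).toReal, ENNReal.toReal_nonneg, fun x => ?_⟩
  rw [ENNReal.ofReal_toReal (by simp [hU.ne])]
  -- A unit interval meets at most two consecutive integer cells, hence the constant `s + s`.
  have hsub : Ioc x (x + 1) ⊆ Ioc ((⌊x⌋ : ℤ) : ℝ) (⌊x⌋ + 1) ∪
      Ioc (((⌊x⌋ + 1 : ℤ)) : ℝ) ((⌊x⌋ + 1 : ℤ) + 1) := by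
    intro y hy
    have h1 := Int.floor_le x
    have h2 := Int.lt_floor_add_one x
    push_cast
    rcases le_or_gt y (⌊x⌋ + 1) with h | h
    · exact Or.inl ⟨by linarith [hy.1], h⟩
    · exact Or.inr ⟨h, by linarith [hy.2]⟩
  calc U (Ioc x (x + 1)) ≤ _ := measure_mono hsub
    _ ≤ _ := measure_union_le _ _
    _ ≤ s + s := add_le_add (le_iSup (fun k : ℤ => U (Ioc (k : ℝ) (k + 1))) _)
        (le_iSup (fun k : ℤ => U (Ioc (k : ℝ) (k + 1))) _)

/-- The shift by `b` affects only finitely many terms beyond a reindexing, and the two half-lines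
are symmetric. -/
theorem summable_antitone_abs_int {τ : ℝ → ℝ} (hτ : Antitone τ) (h0 : ∀ t, 0 ≤ τ t)
    (hs : Summable fun n : ℕ => τ n) (b : ℝ) : Summable fun k : ℤ => τ (|(k : ℝ)| - b) := by
  have key : Summable fun n : ℕ => τ ((n : ℝ) - b) := by
    obtain ⟨N, hN⟩ := exists_nat_ge b
    rw [← summable_nat_add_iff N]
    refine hs.of_nonneg_of_le (fun _ => h0 _) fun n => hτ ?_
    push_cast; linarith
  refine Summable.of_nat_of_neg ?_ ?_ <;> simpa using key

theorem abs_sub_ge_of_mem_Ioc {x y : ℝ} {k : ℤ} (hy : y ∈ Ioc (x + k) (x + k + 1)) :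
    |(k : ℝ)| - 1 ≤ |y - x| := by
  have h1 : |(k : ℝ)| ≤ |y - x| + |(k : ℝ) - (y - x)| := by
    have := abs_add_le (y - x) ((k : ℝ) - (y - x)); simpa using this
  have h2 : |(k : ℝ) - (y - x)| ≤ 1 := abs_le.2 ⟨by linarith [hy.2], by linarith [hy.1]⟩
  linarith

section Window

variable {U : Measure ℝ} {C : ℝ}

theorem setIntegral_unit_le (hC : 0 ≤ C) (hU : ∀ x : ℝ, U (Ioc x (x + 1)) ≤ ENNReal.ofReal C)
    {g : ℝ → ℝ} {x b : ℝ} (hb : ∀ᵐ y ∂U, y ∈ Ioc x (x + 1) → |g y| ≤ b) (hb0 : 0 ≤ b) :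
    ‖∫ y in Ioc x (x + 1), g y ∂U‖ ≤ b * C := by
  have hlt : U (Ioc x (x + 1)) < ⊤ := (hU x).trans_lt ENNReal.ofReal_lt_top
  refine (norm_setIntegral_le_of_norm_le_const_ae' hlt (C := b) ?_).trans ?_
  · filter_upwards [hb] with y hy using hy
  · refine mul_le_mul_of_nonneg_left ?_ hb0
    exact ENNReal.toReal_le_of_le_ofReal hC (hU x)

theorem integrableOn_unit (hU : ∀ x : ℝ, U (Ioc x (x + 1)) ≤ ENNReal.ofReal C)
    {g : ℝ → ℝ} (hg : AEStronglyMeasurable g U) {x b : ℝ}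
    (hb : ∀ᵐ y ∂U, y ∈ Ioc x (x + 1) → |g y| ≤ b) : IntegrableOn g (Ioc x (x + 1)) U := by
  have hlt : U (Ioc x (x + 1)) < ⊤ := (hU x).trans_lt ENNReal.ofReal_lt_top
  refine Measure.integrableOn_of_bounded hlt.ne hg (M := b) ?_
  rw [ae_restrict_iff' measurableSet_Ioc]
  exact hb

theorem ae_unit_le {τ : ℝ → ℝ} (hτ : Antitone τ) {g : ℝ → ℝ} {x a : ℝ}
    (hb : ∀ᵐ y ∂U, |g y| ≤ τ (|y - x| - a)) (k : ℤ) :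
    ∀ᵐ y ∂U, y ∈ Ioc (x + k) (x + k + 1) → |g y| ≤ τ (|(k : ℝ)| - (1 + a)) := by
  filter_upwards [hb] with y hy hyk
  exact hy.trans (hτ (by linarith [abs_sub_ge_of_mem_Ioc hyk]))

/-- A function with a summable radially decreasing majorant is integrable for a measure
giving bounded mass to unit intervals. -/
theorem integrable_of_radial_bound (hC : 0 ≤ C)
    (hU : ∀ x : ℝ, U (Ioc x (x + 1)) ≤ ENNReal.ofReal C)
    {τ : ℝ → ℝ} (hτ : Antitone τ) (h0 : ∀ t, 0 ≤ τ t) (hs : Summable fun n : ℕ => τ n)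
    {g : ℝ → ℝ} (hg : AEStronglyMeasurable g U) {x a : ℝ}
    (hb : ∀ᵐ y ∂U, |g y| ≤ τ (|y - x| - a)) : Integrable g U := by
  rw [← integrableOn_univ, ← iUnion_Ioc_add_intCast x]
  have hk := ae_unit_le hτ hb
  refine integrableOn_iUnion_of_summable_integral_norm
    (fun k => integrableOn_unit hU hg (hk k)) ?_
  refine ((summable_antitone_abs_int hτ h0 hs (1 + a)).mul_right C).of_nonneg_of_le
    (fun k => integral_nonneg fun _ => norm_nonneg _) fun k => ?_
  refine (le_abs_self _).trans (setIntegral_unit_le hC hU ?_ (h0 _))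
  filter_upwards [hk k] with y hy h
  simpa using hy h

/-- Dominated convergence in a moving window. -/
theorem tendsto_integral_moving_window (hC : 0 ≤ C)
    (hU : ∀ x : ℝ, U (Ioc x (x + 1)) ≤ ENNReal.ofReal C)
    {τ : ℝ → ℝ} (hτ : Antitone τ) (h0 : ∀ t, 0 ≤ τ t) (hs : Summable fun n : ℕ => τ n)
    {H : ℝ → ℝ → ℝ} (hg : ∀ x, AEStronglyMeasurable (H x) U) {a : ℝ}
    (hb : ∀ x, ∀ᵐ y ∂U, |H x y| ≤ τ (|y - x| - a))
    (hlim : ∀ A ε : ℝ, 0 < ε → ∀ᶠ x in atTop, ∀ᵐ y ∂U, |y - x| ≤ A → |H x y| ≤ ε) :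
    Tendsto (fun x => ∫ y, H x y ∂U) atTop (𝓝 0) := by
  have hsum : ∀ x, ∫ y, H x y ∂U = ∑' k : ℤ, ∫ y in Ioc (x + k) (x + k + 1), H x y ∂U := by
    intro x
    have hI := integrable_of_radial_bound hC hU hτ h0 hs (hg x) (hb x)
    rw [← integrableOn_univ, ← iUnion_Ioc_add_intCast x] at hI
    have := hasSum_integral_iUnion (fun k : ℤ => measurableSet_Ioc)
      (pairwise_disjoint_Ioc_add_intCast x) hI
    rw [this.tsum_eq, iUnion_Ioc_add_intCast, Measure.restrict_univ]
  simp_rw [hsum]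
  have h00 : (0 : ℝ) = ∑' _ : ℤ, (0 : ℝ) := by simp
  rw [h00]
  -- Cells are numbered relative to `x`, so the dominating series does not depend on `x`; it remains
  -- to treat each cell separately, where `hlim` applies with `A = |k| + 1`.
  refine tendsto_tsum_of_dominated_convergence
    ((summable_antitone_abs_int hτ h0 hs (1 + a)).mul_right C) (fun k => ?_)
    (Eventually.of_forall fun x k => setIntegral_unit_le hC hU (ae_unit_le hτ (hb x) k) (h0 _))
  rw [Metric.tendsto_nhds]
  intro ε hε
  have hε' : 0 < ε / (C + 1) := by positivity
  filter_upwards [hlim (|(k : ℝ)| + 1) _ hε'] with x hx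
  rw [dist_zero_right]
  have : ‖∫ y in Ioc (x + k) (x + k + 1), H x y ∂U‖ ≤ ε / (C + 1) * C := by
    refine setIntegral_unit_le hC hU ?_ hε'.le
    filter_upwards [hx] with y hy hyk
    refine hy ?_
    have h1 : |y - x - k| ≤ 1 := abs_le.2 ⟨by linarith [hyk.1], by linarith [hyk.2]⟩
    have := abs_add_le (k : ℝ) (y - x - k)
    rw [add_sub_cancel] at this
    linarith
  refine this.trans_lt ?_
  rw [div_mul_eq_mul_div, div_lt_iff₀ (by positivity)]
  nlinarith

theorem measure_Icc_lt_top_of_unit (hU : ∀ x : ℝ, U (Ioc x (x + 1)) ≤ ENNReal.ofReal C) (l r : ℝ) :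
    U (Icc l r) < ⊤ := by
  obtain ⟨N, hN⟩ := exists_nat_gt (r - l + 1)
  have hsub : Icc l r ⊆ ⋃ i ∈ Finset.range N, Ioc (l - 1 + i) (l - 1 + i + 1) := by
    intro y hy
    have hy0 : 0 ≤ y - l := by linarith [hy.1]
    have hc := Nat.ceil_lt_add_one (show 0 ≤ y - (l - 1) by linarith)
    have hc2 := Nat.le_ceil (y - (l - 1))
    have hpos : 0 < ⌈y - (l - 1)⌉₊ := Nat.ceil_pos.2 (by linarith)
    obtain ⟨m, hm⟩ := Nat.exists_eq_succ_of_ne_zero hpos.ne'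
    rw [hm] at hc hc2
    push_cast at hc hc2
    simp only [mem_iUnion, Finset.mem_range]
    refine ⟨m, ?_, by linarith, by linarith⟩
    have : (m : ℝ) < N := by linarith [hy.2]
    exact_mod_cast this
  refine (measure_mono hsub).trans_lt ?_
  refine (measure_biUnion_finset_le _ _).trans_lt ?_
  exact ENNReal.sum_lt_top.2 fun i _ => (hU _).trans_lt ENNReal.ofReal_lt_top

end Window

/-! ### Step functions and their mean increments -/

/-- `f` is a bounded uniformly continuous function vanishing on the left of `-a` and equal to `c`
on the right of `a`. -/
structure IsStep (f : ℝ → ℝ) (a c M : ℝ) : Prop where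
  uniformContinuous : UniformContinuous f
  abs_le : ∀ t, |f t| ≤ M
  left : ∀ t ≤ -a, f t = 0
  right : ∀ t, a ≤ t → f t = c

/-- The mean increment of `f` at `t` over a jump with law `J`. -/
noncomputable def meanIncrement (J : Measure ℝ) (f : ℝ → ℝ) (t : ℝ) : ℝ := ∫ z, (f (t + z) - f t) ∂J

section MeanIncrement

variable {f : ℝ → ℝ} {a c M : ℝ}

theorem IsStep.nonneg (hf : IsStep f a c M) : 0 ≤ M := (abs_nonneg _).trans (hf.abs_le 0)

/-- A jump no longer than `|t| - a` cannot leave the half-line on which `f` is constant. Tails of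
the jump law therefore control mean increments at distant points. -/
theorem IsStep.increment_eq_zero (hf : IsStep f a c M) {t z : ℝ} (h : |z| ≤ |t| - a) :
    f (t + z) - f t = 0 := by
  have h1 := le_abs_self z
  have h2 := neg_abs_le z
  have h3 := abs_nonneg z
  rcases abs_cases t with ⟨ht, _⟩ | ⟨ht, _⟩
  · rw [hf.right _ (by linarith), hf.right _ (by linarith), sub_self]
  · rw [hf.left _ (by linarith), hf.left _ (by linarith), sub_self]

theorem IsStep.abs_increment_le (hf : IsStep f a c M) (t z : ℝ) :
    |f (t + z) - f t| ≤ {z : ℝ | |t| - a < |z|}.indicator (fun _ => 2 * M) z := by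
  by_cases h : |t| - a < |z|
  · rw [indicator_of_mem (show z ∈ {z : ℝ | |t| - a < |z|} from h)]
    exact (abs_sub _ _).trans (by linarith [hf.abs_le t, hf.abs_le (t + z)])
  · rw [indicator_of_notMem (show z ∉ {z : ℝ | |t| - a < |z|} from h),
      hf.increment_eq_zero (not_lt.1 h), abs_zero]

theorem measurableSet_lt_abs (b : ℝ) : MeasurableSet {z : ℝ | b < |z|} :=
  measurableSet_lt measurable_const measurable_norm

theorem IsStep.abs_meanIncrement_le (hf : IsStep f a c M) (J : Measure ℝ) [IsProbabilityMeasure J]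
    (t : ℝ) : |meanIncrement J f t| ≤ 2 * M * J.real {z : ℝ | |t| - a < |z|} := by
  have h := norm_integral_le_of_norm_le (μ := J) (f := fun z => f (t + z) - f t)
    ((integrable_const (2 * M)).indicator (measurableSet_lt_abs (|t| - a)))
    (Eventually.of_forall fun z => hf.abs_increment_le t z)
  rw [integral_indicator_const _ (measurableSet_lt_abs _), smul_eq_mul, mul_comm] at h
  exact h

/-- The modulus of continuity obtained is the same for all laws `J`; this equicontinuity upgrades
pointwise convergence to locally uniform convergence. -/
theorem abs_meanIncrement_sub_le (hc : UniformContinuous f) (hM : ∀ t, |f t| ≤ M) {ε δ : ℝ}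
    (hδ : ∀ ⦃s t : ℝ⦄, dist s t < δ → dist (f s) (f t) < ε) (J : Measure ℝ)
    [IsProbabilityMeasure J] {s t : ℝ} (hst : dist s t < δ) :
    |meanIncrement J f s - meanIncrement J f t| ≤ 2 * ε := by
  have hi : ∀ t, Integrable (fun z => f (t + z) - f t) J := fun t =>
    Integrable.of_bound (C := 2 * M)
      ((hc.continuous.comp (continuous_const.add continuous_id)).sub
        continuous_const).aestronglyMeasurable
      (Eventually.of_forall fun z => (abs_sub _ _).trans (by linarith [hM t, hM (t + z)]))
  unfold meanIncrement
  rw [← integral_sub (hi s) (hi t)]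
  have := norm_integral_le_of_norm_le_const (μ := J) (C := 2 * ε)
    (f := fun z => f (s + z) - f s - (f (t + z) - f t)) (Eventually.of_forall fun z => by
      have h1 := hδ hst
      have h2 := hδ (show dist (s + z) (t + z) < δ by rwa [dist_add_right])
      rw [Real.dist_eq] at h1 h2
      have e : f (s + z) - f s - (f (t + z) - f t) = (f (s + z) - f (t + z)) - (f s - f t) := by
        ring
      rw [Real.norm_eq_abs, e]
      exact (abs_sub _ _).trans (by linarith))
  simpa using this

/-- Under weak convergence of the jump laws, mean increments converge locally uniformly. -/
theorem eventually_meanIncrement_close {ι : Type*} {l : Filter ι} {J : ι → ProbabilityMeasure ℝ}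
    {F : ProbabilityMeasure ℝ} (h : Tendsto J l (𝓝 F)) (hc : UniformContinuous f)
    (hM : ∀ t, |f t| ≤ M) (A : ℝ) {ε : ℝ} (hε : 0 < ε) :
    ∀ᶠ i in l, ∀ t, |t| ≤ A →
      |meanIncrement (J i : Measure ℝ) f t - meanIncrement (F : Measure ℝ) f t| ≤ ε := by
  -- Passing to the nearest point of a finite net costs `ε / 4` for each of the two laws, and the
  -- net itself costs `ε / 2`.
  obtain ⟨δ, hδ, hδ'⟩ := Metric.uniformContinuous_iff.1 hc (ε / 8) (by positivity)
  obtain ⟨T, -, hT, hcov⟩ := (isCompact_Icc (a := -A) (b := A)).finite_cover_balls hδ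
  have hpt : ∀ s, Tendsto (fun i => meanIncrement (J i : Measure ℝ) f s) l
      (𝓝 (meanIncrement (F : Measure ℝ) f s)) := by
    intro s
    let g : BoundedContinuousFunction ℝ ℝ := BoundedContinuousFunction.ofNormedAddCommGroup
      (fun z => f (s + z) - f s)
      ((hc.continuous.comp (continuous_const.add continuous_id)).sub continuous_const) (2 * M)
      (fun z => (abs_sub _ _).trans (by linarith [hM s, hM (s + z)]))
    exact ProbabilityMeasure.tendsto_iff_forall_integral_tendsto.1 h g
  have hfin : ∀ᶠ i in l, ∀ s ∈ T,
      |meanIncrement (J i : Measure ℝ) f s - meanIncrement (F : Measure ℝ) f s| < ε / 2 := by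
    refine (eventually_all_finite hT).2 fun s _ => ?_
    have := Metric.tendsto_nhds.1 (hpt s) (ε / 2) (by positivity)
    simpa only [Real.dist_eq] using this
  filter_upwards [hfin] with i hi t ht
  have htm := hcov (show t ∈ Icc (-A) A from abs_le.1 ht)
  simp only [mem_iUnion, Metric.mem_ball] at htm
  obtain ⟨s, hs, hts⟩ := htm
  have h1 := abs_le.1 (abs_meanIncrement_sub_le hc hM hδ' (J i : Measure ℝ) hts)
  have h2 := abs_le.1 (abs_meanIncrement_sub_le hc hM hδ' (F : Measure ℝ) hts)
  have h3 := abs_lt.1 (hi s hs)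
  exact abs_le.2 ⟨by linarith [h1.1, h2.2, h3.1], by linarith [h1.2, h2.1, h3.2]⟩

theorem continuous_meanIncrement (hc : UniformContinuous f) (hM : ∀ t, |f t| ≤ M) (J : Measure ℝ)
    [IsProbabilityMeasure J] : Continuous (meanIncrement J f) := by
  refine Metric.continuous_iff.2 fun t ε hε => ?_
  obtain ⟨δ, hδ, hδ'⟩ := Metric.uniformContinuous_iff.1 hc (ε / 4) (by positivity)
  refine ⟨δ, hδ, fun s hs => ?_⟩
  rw [Real.dist_eq]
  have := abs_meanIncrement_sub_le hc hM hδ' J hs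
  linarith

end MeanIncrement

/-! ### One-step evolution of the laws of the chain -/

section Chain

variable {Ω : Type*} [MeasurableSpace Ω] {μ : Measure Ω} [IsProbabilityMeasure μ]
  {P : Kernel ℝ ℝ} [IsMarkovKernel P] {X : ℕ → Ω → ℝ}

theorem meanIncrement_jumpLaw {f : ℝ → ℝ} (hf : Continuous f) (x y : ℝ) :
    meanIncrement (jumpLaw P y : Measure ℝ) f (y - x) = ∫ w, (f (w - x) - f (y - x)) ∂(P y) := by
  unfold meanIncrement
  change ∫ z, _ ∂((P y).map (fun w => w - y)) = _
  rw [integral_map (by fun_prop) (by fun_prop)]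
  refine integral_congr_ae (Eventually.of_forall fun w => ?_)
  simp only
  congr 2
  ring

/-- Taking expectations in the conditional probability removes the past. Only this recursion for the
marginal laws is needed afterwards. -/
theorem IsMarkovChain.map_succ (hX : IsMarkovChain μ P X) (n : ℕ) :
    μ.map (X (n + 1)) = (μ.map (X n)).bind P := by
  have hle : MeasurableSpace.comap (fun ω (i : Fin (n + 1)) => X i ω) inferInstance ≤
      ‹MeasurableSpace Ω› :=
    Measurable.comap_le (measurable_pi_iff.2 fun i : Fin (n + 1) => hX.measurable i)
  ext B hB
  rw [Measure.map_apply (hX.measurable _) hB, Measure.bind_apply hB P.aemeasurable,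
    lintegral_map (P.measurable_coe hB) (hX.measurable n)]
  have h1 := integral_condExp (μ := μ) (f := (X (n + 1) ⁻¹' B).indicator (fun _ => (1 : ℝ))) hle
  rw [integral_congr_ae (hX.markov n B hB), integral_indicator_const _ (hX.measurable _ hB),
    smul_eq_mul, mul_one] at h1
  have hmeas : Measurable fun ω => P (X n ω) B := (P.measurable_coe hB).comp (hX.measurable n)
  unfold Measure.real at h1
  rw [integral_toReal hmeas.aemeasurable (Eventually.of_forall fun ω => measure_lt_top _ _)] at h1
  refine ((ENNReal.toReal_eq_toReal_iff' ?_ (measure_ne_top _ _)).1 h1).symm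
  refine (lt_of_le_of_lt (lintegral_mono fun ω => prob_le_one) ?_).ne
  simp

theorem IsMarkovChain.integral_map_succ (hX : IsMarkovChain μ P X) (n : ℕ) {g : ℝ → ℝ} {M : ℝ}
    (hg : Continuous g) (hM : ∀ t, |g t| ≤ M) :
    ∫ y, g y ∂(μ.map (X (n + 1))) = ∫ y, ∫ w, g w ∂(P y) ∂(μ.map (X n)) := by
  have : IsProbabilityMeasure (μ.map (X n)) :=
    Measure.isProbabilityMeasure_map (hX.measurable n).aemeasurable
  have : IsProbabilityMeasure (μ.map (X (n + 1))) :=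
    Measure.isProbabilityMeasure_map (hX.measurable _).aemeasurable
  have hi : Integrable g (μ.map (X (n + 1))) := Integrable.of_bound (C := M)
      hg.aestronglyMeasurable (Eventually.of_forall fun z => hM _)
  rw [hX.map_succ n] at hi ⊢
  rw [Measure.comp_eq_comp_const_apply] at hi ⊢
  rw [Kernel.integral_comp hi, Kernel.const_apply]

end Chain

/-! ### An asymptotic Choquet–Deny theorem -/

section ChoquetDeny

variable {F : Measure ℝ} [IsProbabilityMeasure F]

theorem tendsto_measureReal_Ioi_sub (F : Measure ℝ) [IsProbabilityMeasure F] (b : ℝ) :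
    Tendsto (fun x : ℝ => F.real (Ioi (x - b))) atTop (𝓝 0) := by
  have h := tendsto_measure_iInter_atTop (μ := F) (s := fun x : ℝ => Ioi x)
    (fun x => measurableSet_Ioi.nullMeasurableSet)
    (fun x y h => Ioi_subset_Ioi h) ⟨0, measure_ne_top _ _⟩
  have h0 : (⋂ x : ℝ, Ioi x) = ∅ := by
    ext z; simp only [mem_iInter, mem_Ioi, mem_empty_iff_false, iff_false, not_forall, not_lt]
    exact ⟨z, le_rfl⟩
  rw [h0, measure_empty] at h
  have h2 := (ENNReal.tendsto_toReal ENNReal.zero_ne_top).comp h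
  exact h2.comp (tendsto_atTop_add_const_right _ (-b) tendsto_id)

/-- A point of the support transports near-maximal values of an asymptotically harmonic
function. -/
theorem near_limsup_sub {h : ℝ → ℝ} {B L a : ℝ} (hB : ∀ x, |h x| ≤ B) (huc : UniformContinuous h)
    (hharm : Tendsto (fun x => ∫ z, h (x - z) ∂F - h x) atTop (𝓝 0))
    (hL : ∀ ε > 0, ∀ᶠ x in atTop, h x < L + ε) (ha : a ∈ F.support) {ε' : ℝ} (hε' : 0 < ε') :
    ∃ ε > 0, ∀ᶠ x in atTop, L - ε < h x → L - ε' < h (x - a) := by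
  obtain ⟨δ, hδ, hδ'⟩ := Metric.uniformContinuous_iff.1 huc (ε' / 2) (by positivity)
  have hp : 0 < F.real (Metric.ball a δ) := by
    have : 0 < F (Metric.ball a δ) :=
      (Measure.mem_support_iff_forall a).1 ha _ (Metric.ball_mem_nhds a hδ)
    exact ENNReal.toReal_pos this.ne' (measure_ne_top _ _)
  set p := F.real (Metric.ball a δ) with hpdef
  -- If `h (x - a) ≤ L - ε'`, then `h (x - z)` is at most `L - ε' / 2` for `z` in the ball. The mean
  -- is then below `L + 2ε - ε'p/2 = L - 6ε`, whereas near-harmonicity puts it above `L - 2ε`.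
  set ε := ε' * p / 16 with hε
  have hεpos : 0 < ε := by positivity
  refine ⟨ε, hεpos, ?_⟩
  obtain ⟨x1, hx1⟩ := eventually_atTop.1 (hL ε hεpos)
  have hB0 : 0 ≤ B := (abs_nonneg _).trans (hB 0)
  -- `K` absorbs the crude bound on `h (x - z)` for the rare `z` that bring `x - z` below `x1`,
  -- where closeness to the limsup is not available.
  set K := 2 * B + |L| + ε' with hK
  have hKpos : 0 < K := by positivity
  have htail : ∀ᶠ x in atTop, F.real (Ioi (x - x1)) < ε / K :=
    (tendsto_measureReal_Ioi_sub F x1).eventually (gt_mem_nhds (by positivity))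
  have hh : ∀ᶠ x in atTop, -ε < ∫ z, h (x - z) ∂F - h x :=
    hharm.eventually (lt_mem_nhds (by linarith))
  filter_upwards [htail, hh] with x hx2 hx3 hx4
  by_contra hcon
  push Not at hcon
  have hpt : ∀ z, h (x - z) ≤ (L + ε) - (ε' / 2) * (Metric.ball a δ).indicator 1 z
      + K * (Ioi (x - x1)).indicator 1 z := by
    intro z
    have hLa := neg_abs_le L
    have hbz := (abs_le.1 (hB (x - z))).2
    by_cases hz : z ∈ Ioi (x - x1)
    · rw [indicator_of_mem hz]
      have : (Metric.ball a δ).indicator (1 : ℝ → ℝ) z ≤ 1 :=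
        indicator_le' (fun _ _ => le_rfl) (fun _ _ => zero_le_one) z
      have h5 : (ε' / 2) * (Metric.ball a δ).indicator (1 : ℝ → ℝ) z ≤ ε' / 2 * 1 :=
        mul_le_mul_of_nonneg_left this (by positivity)
      simp only [Pi.one_apply, mul_one] at h5 ⊢
      linarith
    · rw [indicator_of_notMem hz]
      by_cases hz2 : z ∈ Metric.ball a δ
      · rw [indicator_of_mem hz2]
        have hd : dist (x - z) (x - a) < δ := by
          rw [dist_sub_left]; exact hz2
        have h6 := hδ' hd
        rw [Real.dist_eq] at h6
        have := (abs_lt.1 h6).2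
        simp only [Pi.one_apply]
        linarith
      · rw [indicator_of_notMem hz2]
        have := hx1 (x - z) (by simp only [mem_Ioi, not_lt] at hz; linarith)
        linarith
  have hi1 : Integrable ((Metric.ball a δ).indicator (1 : ℝ → ℝ)) F :=
    (integrable_const (1 : ℝ)).indicator Metric.isOpen_ball.measurableSet
  have hi2 : Integrable ((Ioi (x - x1)).indicator (1 : ℝ → ℝ)) F :=
    (integrable_const (1 : ℝ)).indicator measurableSet_Ioi
  have hmeanle : ∫ z, h (x - z) ∂F ≤ (L + ε) - (ε' / 2) * p + K * F.real (Ioi (x - x1)) := by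
    have hle := integral_mono (μ := F) (f := fun z => h (x - z))
      (Integrable.of_bound (C := B)
        (huc.continuous.comp (continuous_const.sub continuous_id)).aestronglyMeasurable
        (Eventually.of_forall fun z => hB _))
      (((integrable_const (L + ε)).sub (hi1.const_mul (ε' / 2))).add (hi2.const_mul K)) hpt
    refine hle.trans (le_of_eq ?_)
    rw [integral_add' ((integrable_const (L + ε)).sub (hi1.const_mul (ε' / 2))) (hi2.const_mul K),
      integral_sub' (integrable_const (L + ε)) (hi1.const_mul (ε' / 2)),
      integral_const_mul, integral_const_mul,
      integral_indicator_one Metric.isOpen_ball.measurableSet,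
      integral_indicator_one measurableSet_Ioi, integral_const, probReal_univ, one_smul]
  have hK2 : K * F.real (Ioi (x - x1)) < ε := by
    rw [lt_div_iff₀ hKpos] at hx2; linarith
  have : ε' * p = 16 * ε := by rw [hε]; ring
  linarith

/-- The tolerance is chosen backwards: the induction hypothesis is applied at `x - a`, and
`near_limsup_sub` supplies the accuracy it needs there. -/
theorem near_limsup_sub_iterate {h : ℝ → ℝ} {B L a : ℝ} (hB : ∀ x, |h x| ≤ B)
    (huc : UniformContinuous h)
    (hharm : Tendsto (fun x => ∫ z, h (x - z) ∂F - h x) atTop (𝓝 0))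
    (hL : ∀ ε > 0, ∀ᶠ x in atTop, h x < L + ε) (ha : a ∈ F.support) (N : ℕ) :
    ∀ ε' : ℝ, 0 < ε' →
    ∃ ε > 0, ∀ᶠ x in atTop, L - ε < h x → ∀ k < N, L - ε' < h (x - k * a) := by
  induction N with
  | zero => exact fun ε' hε' => ⟨ε', hε', Eventually.of_forall fun x _ k hk => by omega⟩
  | succ N ih =>
    intro ε' hε'
    obtain ⟨ε₁, h₁, H₁⟩ := ih ε' hε'
    obtain ⟨ε₂, h₂, H₂⟩ := near_limsup_sub hB huc hharm hL ha h₁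
    refine ⟨min ε' ε₂, lt_min hε' h₂, ?_⟩
    have H₁' := (tendsto_atTop_add_const_right _ (-a) tendsto_id).eventually H₁
    filter_upwards [H₁', H₂] with x hx1 hx2 hx k hk
    rcases k with _ | k
    · have := min_le_left ε' ε₂
      simp only [Nat.cast_zero, zero_mul, sub_zero]
      linarith
    · have h3 : L - ε₂ < h x := by have := min_le_right ε' ε₂; linarith
      have h4 := hx1 (by simpa [← sub_eq_add_neg] using hx2 h3) k (by omega)
      convert h4 using 2
      push_cast
      simp only [id]
      ring

/-- The increment `h x = G x - G (x - a)` is again asymptotically harmonic. Were its limsup `L`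
positive, `N` successive increments would exceed `L / 2`, and their telescoping sum would exceed the
oscillation bound `2 * B` of `G`. -/
theorem eventually_sub_lt_of_mem_support {G : ℝ → ℝ} {B a : ℝ} (hB : ∀ x, |G x| ≤ B)
    (huc : UniformContinuous G)
    (hharm : Tendsto (fun x => ∫ z, G (x - z) ∂F - G x) atTop (𝓝 0))
    (ha : a ∈ F.support) {ε : ℝ} (hε : 0 < ε) : ∀ᶠ x in atTop, G x - G (x - a) < ε := by
  set h : ℝ → ℝ := fun x => G x - G (x - a) with hh
  have hshift : Tendsto (fun x : ℝ => x - a) atTop atTop :=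
    tendsto_atTop_add_const_right _ (-a) tendsto_id
  have hB' : ∀ x, |h x| ≤ 2 * B := fun x => (abs_sub _ _).trans (by linarith [hB x, hB (x - a)])
  have huc' : UniformContinuous h := huc.sub (huc.comp (uniformContinuous_id.sub
    uniformContinuous_const))
  have hi : ∀ x, Integrable (fun z => G (x - z)) F := fun x =>
    Integrable.of_bound (C := B)
      (huc.continuous.comp (continuous_const.sub continuous_id)).aestronglyMeasurable
      (Eventually.of_forall fun z => hB _)
  have hharm' : Tendsto (fun x => ∫ z, h (x - z) ∂F - h x) atTop (𝓝 0) := by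
    have := hharm.sub (hharm.comp hshift)
    rw [sub_zero] at this
    refine this.congr fun x => ?_
    simp only [hh, Function.comp]
    have e : ∀ z, x - z - a = x - a - z := fun z => by ring
    simp_rw [e]
    rw [integral_sub (hi x) (hi (x - a))]
    ring
  have hbdd : IsBoundedUnder (· ≤ ·) atTop h :=
    isBoundedUnder_of ⟨2 * B, fun x => (abs_le.1 (hB' x)).2⟩
  have hbdd' : IsBoundedUnder (· ≥ ·) atTop h :=
    isBoundedUnder_of ⟨-(2 * B), fun x => (abs_le.1 (hB' x)).1⟩
  set L := limsup h atTop with hLdef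
  have hL : ∀ ε > 0, ∀ᶠ x in atTop, h x < L + ε := fun ε hε =>
    eventually_lt_of_limsup_lt (by linarith) hbdd
  have hL0 : L ≤ 0 := by
    by_contra hpos
    push Not at hpos
    obtain ⟨N, hN⟩ := exists_nat_gt (2 * B / (L / 2))
    obtain ⟨ε₁, h₁, H₁⟩ := near_limsup_sub_iterate hB' huc' hharm' hL ha N (L / 2) (by positivity)
    have hfreq : ∃ᶠ x in atTop, L - ε₁ < h x :=
      frequently_lt_of_lt_limsup hbdd'.isCoboundedUnder_le (by linarith)
    obtain ⟨x, hx, hx'⟩ := (hfreq.and_eventually H₁).exists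
    have hk := hx' hx
    have htel : ∀ M : ℕ, ∑ k ∈ Finset.range M, h (x - k * a) = G x - G (x - M * a) := by
      intro M
      induction M with
      | zero => simp
      | succ M ih =>
        rw [Finset.sum_range_succ, ih]
        simp only [hh]
        have : x - M * a - a = x - (M + 1 : ℕ) * a := by push_cast; ring
        rw [this]; ring
    have hsum : (N : ℝ) * (L / 2) ≤ ∑ k ∈ Finset.range N, h (x - k * a) := by
      have := Finset.card_nsmul_le_sum (Finset.range N) (fun k => h (x - k * a)) (L / 2)
        (fun k hkN => by have := hk k (Finset.mem_range.1 hkN); linarith)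
      simpa using this
    rw [htel] at hsum
    rw [div_lt_iff₀ (by positivity)] at hN
    have h1 := (abs_le.1 (hB x)).2
    have h2 := (abs_le.1 (hB (x - N * a))).1
    linarith
  filter_upwards [hL ε hε] with x hx
  simp only [hh] at hx ⊢
  linarith

/-- An asymptotic form of the Choquet–Deny theorem: a bounded uniformly continuous function which
is asymptotically harmonic for `F` is asymptotically periodic with respect to each point of the
support of `F`. -/
theorem tendsto_sub_of_mem_support {G : ℝ → ℝ} {B a : ℝ} (hB : ∀ x, |G x| ≤ B)
    (huc : UniformContinuous G)
    (hharm : Tendsto (fun x => ∫ z, G (x - z) ∂F - G x) atTop (𝓝 0))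
    (ha : a ∈ F.support) : Tendsto (fun x => G x - G (x - a)) atTop (𝓝 0) := by
  rw [Metric.tendsto_nhds]
  intro ε hε
  have h1 := eventually_sub_lt_of_mem_support hB huc hharm ha hε
  have h2 := eventually_sub_lt_of_mem_support (G := fun x => -G x) (B := B) (F := F)
    (by simpa using hB) huc.neg (by
      have := hharm.neg
      rw [neg_zero] at this
      refine this.congr fun x => ?_
      rw [integral_neg]; ring) ha hε
  filter_upwards [h1, h2] with x hx1 hx2
  rw [Real.dist_eq, sub_zero, abs_lt]
  constructor <;> linarith

/-- The asymptotic periods of a function. -/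
def asymptoticPeriods (G : ℝ → ℝ) : AddSubgroup ℝ where
  carrier := {a | Tendsto (fun x => G x - G (x - a)) atTop (𝓝 0)}
  zero_mem' := by simp
  add_mem' := by
    intro a b ha hb
    have hshift : Tendsto (fun x : ℝ => x - a) atTop atTop :=
      tendsto_atTop_add_const_right _ (-a) tendsto_id
    have := Tendsto.add ha (Tendsto.comp hb hshift)
    rw [add_zero] at this
    refine Tendsto.congr (fun x => ?_) this
    simp only [Function.comp]
    rw [sub_sub]; ring
  neg_mem' := by
    intro a ha
    have hshift : Tendsto (fun x : ℝ => x + a) atTop atTop :=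
      tendsto_atTop_add_const_right _ a tendsto_id
    have := (Tendsto.comp ha hshift).neg
    rw [neg_zero] at this
    refine Tendsto.congr (fun x => ?_) this
    simp

theorem mem_asymptoticPeriods {G : ℝ → ℝ} {a : ℝ} :
    a ∈ asymptoticPeriods G ↔ Tendsto (fun x => G x - G (x - a)) atTop (𝓝 0) := Iff.rfl

theorem mem_asymptoticPeriods_of_dense {G : ℝ → ℝ} (huc : UniformContinuous G)
    (hd : Dense (asymptoticPeriods G : Set ℝ)) (a : ℝ) : a ∈ asymptoticPeriods G := by
  rw [mem_asymptoticPeriods, Metric.tendsto_nhds]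
  intro ε hε
  obtain ⟨δ, hδ, hδ'⟩ := Metric.uniformContinuous_iff.1 huc (ε / 2) (by positivity)
  obtain ⟨b, hb, hab⟩ := hd.exists_dist_lt a hδ
  filter_upwards [(Metric.tendsto_nhds.1 (mem_asymptoticPeriods.1 hb)) (ε / 2) (by positivity)]
    with x hx
  have h2 : dist (G (x - a)) (G (x - b)) < ε / 2 := hδ' (by rwa [dist_sub_left])
  rw [Real.dist_eq] at *
  rw [abs_lt] at *
  constructor <;> linarith [hx.1, hx.2, h2.1, h2.2]

end ChoquetDeny

/-! ### Subgroups carrying the limit law -/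

theorem concentratedOnLattice_of_closure {F : ProbabilityMeasure ℝ} {b : ℝ}
    (hF : ∀ᵐ z ∂(F : Measure ℝ), z ∈ AddSubgroup.closure {b}) : ConcentratedOnLattice F b := by
  have : ∀ᵐ z ∂(F : Measure ℝ), z ∈ {x : ℝ | ∃ k : ℤ, x = k * b} := by
    filter_upwards [hF] with z hz
    obtain ⟨k, hk⟩ := AddSubgroup.mem_closure_singleton.1 hz
    exact ⟨k, by rw [← hk]; simp⟩
  unfold ConcentratedOnLattice
  exact (measure_congr (eventuallyEq_univ.2 this)).trans measure_univ

/-- A subgroup of `ℝ` carrying a non-lattice law is dense. -/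
theorem dense_of_not_isLattice {F : ProbabilityMeasure ℝ} (hF : ¬ IsLattice F)
    {A : AddSubgroup ℝ} (hA : ∀ᵐ z ∂(F : Measure ℝ), z ∈ A) : Dense (A : Set ℝ) := by
  refine A.dense_or_cyclic.resolve_right ?_
  rintro ⟨b, rfl⟩
  apply hF
  rcases lt_trichotomy b 0 with hb | rfl | hb
  · refine ⟨-b, by linarith, concentratedOnLattice_of_closure ?_⟩
    filter_upwards [hA] with z hz
    rw [AddSubgroup.mem_closure_singleton] at hz ⊢
    obtain ⟨n, rfl⟩ := hz
    exact ⟨-n, by simp⟩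
  -- Here `F` is the point mass at 0, which every lattice carries.
  · refine ⟨1, one_pos, concentratedOnLattice_of_closure ?_⟩
    filter_upwards [hA] with z hz
    rw [AddSubgroup.mem_closure_singleton] at hz ⊢
    obtain ⟨n, rfl⟩ := hz
    exact ⟨0, by simp⟩
  · exact ⟨b, hb, concentratedOnLattice_of_closure hA⟩

theorem ae_int_of_hasSpan_one {F : ProbabilityMeasure ℝ} (hF : HasSpan F 1) :
    ∀ᵐ z ∂(F : Measure ℝ), z ∈ AddSubgroup.zmultiples (1 : ℝ) := by
  have h := hF.2.1
  unfold ConcentratedOnLattice at h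
  have hm : MeasurableSet {x : ℝ | ∃ k : ℤ, x = k * 1} := by
    have : {x : ℝ | ∃ k : ℤ, x = k * 1} = range ((↑) : ℤ → ℝ) := by
      ext x; simp [eq_comm]
    rw [this]; exact (countable_range _).measurableSet
  have := (prob_compl_eq_zero_iff hm).2 h
  filter_upwards [compl_mem_ae_iff.2 this] with z hz
  rw [compl_compl] at hz
  obtain ⟨k, rfl⟩ := hz
  exact ⟨k, by simp⟩

/-- The integers in `A` form a group `dℤ` that carries `F`, so maximality of the span forces `|d| ≤
1`. The case `d = 0` is excluded because a point mass at 0 would also live on `2ℤ`. -/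
theorem one_mem_of_hasSpan_one {F : ProbabilityMeasure ℝ} (hF : HasSpan F 1)
    {A : AddSubgroup ℝ} (hA : ∀ᵐ z ∂(F : Measure ℝ), z ∈ A) : (1 : ℝ) ∈ A := by
  set D := A.comap (Int.castAddHom ℝ) with hD
  obtain ⟨d, hd⟩ := Int.subgroup_cyclic D
  have hmem : ∀ᵐ z ∂(F : Measure ℝ), ∃ k : ℤ, z = k * (d : ℝ) := by
    filter_upwards [hA, ae_int_of_hasSpan_one hF] with z hz ⟨k, hk⟩
    have hkD : k ∈ D := by
      rw [hD, AddSubgroup.mem_comap]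
      simp only [Int.coe_castAddHom]
      convert hz
      simpa using hk
    rw [hd, AddSubgroup.mem_closure_singleton] at hkD
    obtain ⟨n, rfl⟩ := hkD
    exact ⟨n, by rw [← hk]; simp⟩
  have hcon : ∀ b : ℝ, (∀ᵐ z ∂(F : Measure ℝ), ∃ k : ℤ, z = k * b) → 0 < b → b ≤ 1 :=
    fun b hb hb0 => hF.2.2 b hb0 (by
      unfold ConcentratedOnLattice
      exact (measure_congr (eventuallyEq_univ.2 hb)).trans measure_univ)
  have hd0 : d ≠ 0 := by
    rintro rfl
    have := hcon 2 (hmem.mono fun z ⟨k, hk⟩ => ⟨0, by simpa using hk⟩) two_pos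
    norm_num at this
  have habs : ((|d| : ℤ) : ℝ) ≤ 1 := by
    refine hcon _ (hmem.mono fun z ⟨k, hk⟩ => ?_) (by exact_mod_cast abs_pos.2 hd0)
    rcases abs_choice d with h | h <;> rw [h]
    · exact ⟨k, hk⟩
    · exact ⟨-k, by rw [hk]; push_cast; ring⟩
  have habs' : |d| ≤ 1 := by exact_mod_cast habs
  have h1 : (1 : ℤ) ∈ D := by
    rw [hd, AddSubgroup.mem_closure_singleton]
    have : d = 1 ∨ d = -1 := by
      have := abs_pos.2 hd0
      rcases abs_cases d with h | h <;> omega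
    rcases this with rfl | rfl
    · exact ⟨1, by simp⟩
    · exact ⟨-1, by simp⟩
  have := AddSubgroup.mem_comap.1 h1
  simpa using this

/-! ### The flux identity for the renewal measure -/

section Flux

variable {Ω : Type*} [MeasurableSpace Ω] {μ : Measure Ω} {P : Kernel ℝ ℝ} {X : ℕ → Ω → ℝ}

theorem IsMarkovChain.isProbabilityMeasure_map [IsProbabilityMeasure μ] (hX : IsMarkovChain μ P X) (n : ℕ) :
    IsProbabilityMeasure (μ.map (X n)) :=
  Measure.isProbabilityMeasure_map (hX.measurable n).aemeasurable

theorem ae_renewalMeasure_mem (hX : IsMarkovChain μ P X) {S : Set ℝ} (hS : MeasurableSet S)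
    (hXS : ∀ n, ∀ᵐ ω ∂μ, X n ω ∈ S) : ∀ᵐ y ∂(renewalMeasure μ X), y ∈ S := by
  unfold renewalMeasure
  rw [Measure.ae_sum_iff]
  exact fun n => (ae_map_iff (hX.measurable n).aemeasurable hS).2 (hXS n)

/-- A common tail of the majorant `ν` of the jumps and of the limit law `F`. -/
noncomputable def jumpTail (ν F : Measure ℝ) (M t : ℝ) : ℝ :=
  2 * M * (ν.real (Ioi t) + F.real {z : ℝ | t < |z|})

section JumpTail

variable {ν F : Measure ℝ} {M : ℝ}

theorem jumpTail_antitone [IsProbabilityMeasure ν] [IsProbabilityMeasure F] (hM : 0 ≤ M) : Antitone (jumpTail ν F M) := fun s t hst =>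
  mul_le_mul_of_nonneg_left (add_le_add (measureReal_mono (Ioi_subset_Ioi hst))
    (measureReal_mono fun _ hz => lt_of_le_of_lt hst hz)) (by positivity)

theorem jumpTail_nonneg (hM : 0 ≤ M) (t : ℝ) : 0 ≤ jumpTail ν F M t := by
  unfold jumpTail; positivity

theorem summable_jumpTail [IsProbabilityMeasure ν] [IsProbabilityMeasure F]
    (hν : Integrable (fun z : ℝ => z) ν)
    (hF : Integrable (fun z : ℝ => z) F) : Summable fun n : ℕ => jumpTail ν F M n :=
  ((summable_measureReal_Ioi ν hν).add (summable_measureReal_lt_abs F hF)).mul_left _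

theorem IsStep.abs_meanIncrement_jumpLaw_le [IsMarkovKernel P]
    [IsProbabilityMeasure ν] {f : ℝ → ℝ} {a c : ℝ} (hf : IsStep f a c M) {S : Set ℝ}
    (hmaj : ∀ x ∈ S, ∀ t : ℝ,
      (jumpLaw P x : Measure ℝ) {z : ℝ | t < |z|} ≤ ν (Set.Ioi t)) {y : ℝ} (hy : y ∈ S) (t : ℝ) :
    |meanIncrement (jumpLaw P y : Measure ℝ) f t| ≤ 2 * M * ν.real (Ioi (|t| - a)) :=
  (hf.abs_meanIncrement_le _ t).trans (mul_le_mul_of_nonneg_left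
    (ENNReal.toReal_mono (measure_ne_top _ _) (hmaj y hy _)) (by linarith [hf.nonneg]))

end JumpTail

variable [IsProbabilityMeasure μ]

theorem measurable_meanIncrement_jumpLaw [IsMarkovKernel P] {f : ℝ → ℝ} (hf : UniformContinuous f) {M : ℝ}
    (hM : ∀ t, |f t| ≤ M) (x : ℝ) :
    StronglyMeasurable fun y => meanIncrement (jumpLaw P y : Measure ℝ) f (y - x) := by
  have e : (fun y => meanIncrement (jumpLaw P y : Measure ℝ) f (y - x)) =
      fun y => ∫ w, f (w - x) ∂(P y) - f (y - x) := by
    funext y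
    rw [meanIncrement_jumpLaw hf.continuous, integral_sub _ (integrable_const _)]
    · simp
    · exact Integrable.of_bound (C := M)
        (hf.continuous.comp (continuous_id.sub continuous_const)).aestronglyMeasurable
        (Eventually.of_forall fun z => hM _)
  rw [e]
  have hc : Continuous fun y => f (y - x) := hf.continuous.comp (continuous_id.sub continuous_const)
  exact (StronglyMeasurable.integral_kernel hc.stronglyMeasurable).sub hc.stronglyMeasurable

variable {C : ℝ} {f : ℝ → ℝ} {a c M : ℝ}

/-- The function `f (y - x)` differs from `c` times the indicator of the positive half-line by a
bounded function of bounded support. That difference is integrable for the renewal measure, so its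
expectations along the chain are summable and tend to 0. -/
theorem tendsto_integral_step (hX : IsMarkovChain μ P X)
    (hU : ∀ x : ℝ, renewalMeasure μ X (Ioc x (x + 1)) ≤ ENNReal.ofReal C)
    {p₀ : ℝ} (hp₀ : Tendsto (fun n : ℕ => μ.real {ω | 0 < X n ω}) atTop (𝓝 p₀))
    (hf : IsStep f a c M) (x : ℝ) :
    Tendsto (fun n => ∫ y, f (y - x) ∂(μ.map (X n))) atTop (𝓝 (c * p₀)) := by
  have hfc : Continuous fun y => f (y - x) :=
    hf.uniformContinuous.continuous.comp (continuous_id.sub continuous_const)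
  set q : ℝ → ℝ := fun y => f (y - x) - (Ioi 0).indicator (fun _ => c) y with hq
  have hqm : Measurable q := hfc.measurable.sub (measurable_const.indicator measurableSet_Ioi)
  have hqI : Integrable q (renewalMeasure μ X) := by
    have hsupp : Function.support q ⊆ Icc (-(|x| + |a|)) (|x| + |a|) := by
      intro y hy
      by_contra hcon
      apply hy
      have h1 := le_abs_self x
      have h2 := neg_abs_le x
      have h3 := le_abs_self a
      have h4 := abs_nonneg a
      have h5 := abs_nonneg x
      simp only [mem_Icc, not_and_or, not_le] at hcon
      simp only [hq]
      rcases hcon with h | h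
      · rw [hf.left _ (by linarith), indicator_of_notMem, sub_self]
        simp only [mem_Ioi, not_lt]; linarith
      · rw [hf.right _ (by linarith), indicator_of_mem, sub_self]
        simp only [mem_Ioi]; linarith
    rw [← integrableOn_iff_integrable_of_support_subset hsupp]
    refine Measure.integrableOn_of_bounded (measure_Icc_lt_top_of_unit hU _ _).ne
      hqm.aestronglyMeasurable (M := M + |c|) (Eventually.of_forall fun y => ?_)
    refine (abs_sub _ _).trans (add_le_add (hf.abs_le _) ?_)
    by_cases h : y ∈ Ioi (0 : ℝ)
    · rw [indicator_of_mem h]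
    · rw [indicator_of_notMem h, abs_zero]; exact abs_nonneg c
  have h0 := (hasSum_integral_measure hqI).summable.tendsto_atTop_zero
  have h1 := h0.add (hp₀.const_mul c)
  rw [zero_add] at h1
  refine h1.congr fun n => ?_
  have := hX.isProbabilityMeasure_map n
  simp only [hq]
  rw [integral_sub _ ((integrable_const c).indicator measurableSet_Ioi),
    integral_indicator_const _ measurableSet_Ioi, smul_eq_mul,
    map_measureReal_apply (hX.measurable n) measurableSet_Ioi]
  · simp only [preimage, mem_Ioi]; ring
  · exact Integrable.of_bound (C := M) hfc.aestronglyMeasurable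
      (Eventually.of_forall fun z => hf.abs_le _)

theorem tendsto_integral_step_sub (m : Measure ℝ) [IsProbabilityMeasure m] (hf : IsStep f a c M) :
    Tendsto (fun x => ∫ y, f (y - x) ∂m) atTop (𝓝 0) := by
  have h := tendsto_integral_filter_of_dominated_convergence (μ := m) (l := (atTop : Filter ℝ))
    (F := fun x y => f (y - x)) (f := fun _ => 0) (fun _ => M)
    (Eventually.of_forall fun x => (hf.uniformContinuous.continuous.comp
      (continuous_id.sub continuous_const)).aestronglyMeasurable)
    (Eventually.of_forall fun x => Eventually.of_forall fun y => hf.abs_le _)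
    (integrable_const _) (Eventually.of_forall fun y => by
      refine tendsto_const_nhds.congr' ?_
      filter_upwards [eventually_ge_atTop (y + a)] with x hx
      rw [hf.left _ (by linarith)])
  simpa using h

variable {ν : Measure ℝ} [IsProbabilityMeasure ν] {F : ProbabilityMeasure ℝ} {S : Set ℝ} {p₀ : ℝ}

variable [IsMarkovKernel P]

/-- The integral against the law of `X n` is the change of `E f(X n - x)` in one step, so the sum
over `n` telescopes. -/
theorem integral_meanIncrement_jumpLaw (hX : IsMarkovChain μ P X) (hC : 0 ≤ C)
    (hU : ∀ x : ℝ, renewalMeasure μ X (Ioc x (x + 1)) ≤ ENNReal.ofReal C)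
    (hS : ∀ᵐ y ∂(renewalMeasure μ X), y ∈ S)
    (hν : Integrable (fun z : ℝ => z) ν)
    (hmaj : ∀ x ∈ S, ∀ t : ℝ,
      (jumpLaw P x : Measure ℝ) {z : ℝ | t < |z|} ≤ ν (Set.Ioi t))
    (hp₀ : Tendsto (fun n : ℕ => μ.real {ω | 0 < X n ω}) atTop (𝓝 p₀))
    (hf : IsStep f a c M) (x : ℝ) :
    ∫ y, meanIncrement (jumpLaw P y : Measure ℝ) f (y - x) ∂(renewalMeasure μ X) =
      c * p₀ - ∫ y, f (y - x) ∂(μ.map (X 0)) := by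
  have hM := hf.nonneg
  have hI : Integrable (fun y => meanIncrement (jumpLaw P y : Measure ℝ) f (y - x))
      (renewalMeasure μ X) := by
    refine integrable_of_radial_bound hC hU (τ := jumpTail ν ν M) (jumpTail_antitone hM)
      (jumpTail_nonneg hM) (summable_jumpTail hν hν) (x := x) (a := a)
      (measurable_meanIncrement_jumpLaw hf.uniformContinuous hf.abs_le x).aestronglyMeasurable ?_
    filter_upwards [hS] with y hy
    refine (hf.abs_meanIncrement_jumpLaw_le hmaj hy _).trans ?_
    exact mul_le_mul_of_nonneg_left (le_add_of_nonneg_right measureReal_nonneg) (by positivity)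
  have hsum := (hasSum_integral_measure hI).tendsto_sum_nat
  have hterm : ∀ n, ∫ y, meanIncrement (jumpLaw P y : Measure ℝ) f (y - x) ∂(μ.map (X n)) =
      ∫ y, f (y - x) ∂(μ.map (X (n + 1))) - ∫ y, f (y - x) ∂(μ.map (X n)) := by
    intro n
    have := hX.isProbabilityMeasure_map n
    have hfc : Continuous fun y => f (y - x) :=
      hf.uniformContinuous.continuous.comp (continuous_id.sub continuous_const)
    have hb : ∀ (J : Measure ℝ) [IsProbabilityMeasure J], Integrable (fun y => f (y - x)) J :=
      fun J _ => Integrable.of_bound (C := M) hfc.aestronglyMeasurable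
        (Eventually.of_forall fun z => hf.abs_le _)
    rw [hX.integral_map_succ n hfc fun t => hf.abs_le _, ← integral_sub _ (hb _)]
    · refine integral_congr_ae (Eventually.of_forall fun y => ?_)
      simp only
      rw [meanIncrement_jumpLaw hf.uniformContinuous.continuous,
        integral_sub (hb _) (integrable_const _)]
      simp
    · refine Integrable.of_bound (C := M)
        (StronglyMeasurable.integral_kernel hfc.stronglyMeasurable).aestronglyMeasurable
        (Eventually.of_forall fun y => ?_)
      simpa using norm_integral_le_of_norm_le_const (μ := P y) (C := M)
        (f := fun w => f (w - x)) (Eventually.of_forall fun w => hf.abs_le (w - x))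
  simp_rw [hterm] at hsum
  have htel : ∀ N : ℕ, ∑ n ∈ Finset.range N, (∫ y, f (y - x) ∂(μ.map (X (n + 1))) -
      ∫ y, f (y - x) ∂(μ.map (X n))) = ∫ y, f (y - x) ∂(μ.map (X N)) -
      ∫ y, f (y - x) ∂(μ.map (X 0)) := fun N =>
    Finset.sum_range_sub (fun n => ∫ y, f (y - x) ∂(μ.map (X n))) N
  simp_rw [htel] at hsum
  exact tendsto_nhds_unique hsum ((tendsto_integral_step hX hU hp₀ hf x).sub_const _)

/-- The asymptotic flux identity with the jumps replaced by the limit law. -/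
theorem tendsto_integral_meanIncrement (hX : IsMarkovChain μ P X) (hC : 0 ≤ C)
    (hU : ∀ x : ℝ, renewalMeasure μ X (Ioc x (x + 1)) ≤ ENNReal.ofReal C)
    (hS : ∀ᵐ y ∂(renewalMeasure μ X), y ∈ S)
    (hweak : Tendsto (fun x : ℝ => jumpLaw P x) (atTop ⊓ 𝓟 S) (𝓝 F))
    (hF : Integrable (fun z : ℝ => z) (F : Measure ℝ))
    (hν : Integrable (fun z : ℝ => z) ν)
    (hmaj : ∀ x ∈ S, ∀ t : ℝ,
      (jumpLaw P x : Measure ℝ) {z : ℝ | t < |z|} ≤ ν (Set.Ioi t))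
    (hp₀ : Tendsto (fun n : ℕ => μ.real {ω | 0 < X n ω}) atTop (𝓝 p₀))
    (hf : IsStep f a c M) :
    Tendsto (fun x => ∫ y, meanIncrement (F : Measure ℝ) f (y - x) ∂(renewalMeasure μ X)) atTop
      (𝓝 (c * p₀)) := by
  have hM := hf.nonneg
  have hτ := jumpTail_antitone (ν := ν) (F := (F : Measure ℝ)) hM
  have hτ0 := jumpTail_nonneg (ν := ν) (F := (F : Measure ℝ)) hM
  have hτs := summable_jumpTail (M := M) hν hF
  have hJm := measurable_meanIncrement_jumpLaw (P := P) hf.uniformContinuous hf.abs_le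
  have hFm : ∀ x, AEStronglyMeasurable (fun y => meanIncrement (F : Measure ℝ) f (y - x))
      (renewalMeasure μ X) := fun x =>
    ((continuous_meanIncrement hf.uniformContinuous hf.abs_le (F : Measure ℝ)).comp
      (continuous_id.sub continuous_const)).aestronglyMeasurable
  have hJb : ∀ y ∈ S, ∀ x, |meanIncrement (jumpLaw P y : Measure ℝ) f (y - x)| ≤
      2 * M * ν.real (Ioi (|y - x| - a)) := fun y hy x =>
    hf.abs_meanIncrement_jumpLaw_le hmaj hy _
  have hFb : ∀ y x, |meanIncrement (F : Measure ℝ) f (y - x)| ≤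
      2 * M * (F : Measure ℝ).real {z : ℝ | |y - x| - a < |z|} := fun y x =>
    hf.abs_meanIncrement_le _ _
  have hdiff : Tendsto (fun x => ∫ y, (meanIncrement (jumpLaw P y : Measure ℝ) f (y - x) -
      meanIncrement (F : Measure ℝ) f (y - x)) ∂(renewalMeasure μ X)) atTop (𝓝 0) := by
    refine tendsto_integral_moving_window hC hU hτ hτ0 hτs (a := a)
      (fun x => (hJm x).aestronglyMeasurable.sub (hFm x)) (fun x => ?_) (fun A ε hε => ?_)
    · filter_upwards [hS] with y hy
      refine (abs_sub _ _).trans ?_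
      unfold jumpTail
      rw [mul_add]
      exact add_le_add (hJb y hy x) (hFb y x)
    · have hcl := eventually_meanIncrement_close hweak hf.uniformContinuous hf.abs_le A hε
      rw [eventually_inf_principal] at hcl
      obtain ⟨y0, hy0⟩ := eventually_atTop.1 hcl
      -- For such `x`, the window `|y - x| ≤ A` lies to the right of `y0`, where the jump law is
      -- already close to `F`.
      filter_upwards [eventually_ge_atTop (y0 + A)] with x hx
      filter_upwards [hS] with y hy hyA
      exact hy0 y (by linarith [(abs_le.1 hyA).1]) hy _ hyA
  have := hX.isProbabilityMeasure_map 0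
  have hmain := (tendsto_integral_step_sub (μ.map (X 0)) hf).const_sub (c * p₀)
  have := hmain.sub hdiff
  rw [sub_zero, sub_zero] at this
  refine this.congr fun x => ?_
  rw [← integral_meanIncrement_jumpLaw hX hC hU hS hν hmaj hp₀ hf x, integral_sub]
  · ring
  · refine integrable_of_radial_bound hC hU hτ hτ0 hτs (x := x) (a := a)
      (hJm x).aestronglyMeasurable ?_
    filter_upwards [hS] with y hy
    exact (hJb y hy x).trans (mul_le_mul_of_nonneg_left
      (le_add_of_nonneg_right measureReal_nonneg) (by positivity))
  · exact integrable_of_radial_bound hC hU hτ hτ0 hτs (x := x) (a := a) (hFm x)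
      (Eventually.of_forall fun y => (hFb y x).trans (mul_le_mul_of_nonneg_left
        (le_add_of_nonneg_left measureReal_nonneg) (by positivity)))

end Flux

/-! ### The smoothed renewal measure -/

section Smoothing

variable {U : Measure ℝ} {C : ℝ}

theorem abs_integral_le_of_radial_bound (hC : 0 ≤ C)
    (hU : ∀ x : ℝ, U (Ioc x (x + 1)) ≤ ENNReal.ofReal C)
    {τ : ℝ → ℝ} (hτ : Antitone τ) (h0 : ∀ t, 0 ≤ τ t) (hs : Summable fun n : ℕ => τ n)
    {g : ℝ → ℝ} (hg : AEStronglyMeasurable g U) {x a : ℝ}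
    (hb : ∀ᵐ y ∂U, |g y| ≤ τ (|y - x| - a)) :
    |∫ y, g y ∂U| ≤ ∑' k : ℤ, τ (|(k : ℝ)| - (1 + a)) * C := by
  have hI := integrable_of_radial_bound hC hU hτ h0 hs hg hb
  rw [← integrableOn_univ, ← iUnion_Ioc_add_intCast x] at hI
  have h := hasSum_integral_iUnion (fun k : ℤ => measurableSet_Ioc)
    (pairwise_disjoint_Ioc_add_intCast x) hI
  rw [iUnion_Ioc_add_intCast, Measure.restrict_univ] at h
  rw [← h.tsum_eq]
  exact tsum_of_norm_bounded
    ((summable_antitone_abs_int hτ h0 hs (1 + a)).mul_right C).hasSum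
    fun k => setIntegral_unit_le hC hU (ae_unit_le hτ hb k) (h0 _)

/-- Functions supported in a window of given size are integrable, and their integrals are
controlled by their sup norms uniformly in the location of the window. -/
theorem exists_integral_le_of_window (hC : 0 ≤ C)
    (hU : ∀ x : ℝ, U (Ioc x (x + 1)) ≤ ENNReal.ofReal C) (a : ℝ) :
    ∃ K : ℝ, 0 ≤ K ∧ ∀ (g : ℝ → ℝ) (x b : ℝ), 0 ≤ b → Continuous g →
      (∀ y, |g y| ≤ b) → (∀ y, a < |y - x| → g y = 0) →
      Integrable g U ∧ |∫ y, g y ∂U| ≤ b * K := by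
  -- This indicator expresses a bounded window as a radial majorant, so that the constant depends on
  -- `a` but not on the location `x`.
  set w : ℝ → ℝ := (Iic 0).indicator (fun _ => 1) with hw
  have hw0 : ∀ t, 0 ≤ w t := fun t => indicator_nonneg (fun _ _ => zero_le_one) t
  have hwa : Antitone w := by
    intro s t hst
    simp only [hw]
    by_cases ht : t ∈ Iic (0 : ℝ)
    · rw [indicator_of_mem ht, indicator_of_mem (show s ∈ Iic (0 : ℝ) from hst.trans ht)]
    · rw [indicator_of_notMem ht]; exact hw0 s
  have hws : Summable fun n : ℕ => w n := by
    refine summable_of_ne_finset_zero (s := {0}) fun n hn => ?_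
    refine indicator_of_notMem ?_ _
    simp only [Finset.mem_singleton] at hn
    simp only [mem_Iic, not_le]
    exact_mod_cast Nat.pos_of_ne_zero hn
  refine ⟨∑' k : ℤ, w (|(k : ℝ)| - (1 + a)) * C, tsum_nonneg fun k => mul_nonneg (hw0 _) hC,
    fun g x b hb hg hgb hgz => ?_⟩
  have hbd : ∀ᵐ y ∂U, |g y| ≤ b * w (|y - x| - a) := by
    refine Eventually.of_forall fun y => ?_
    by_cases hy : a < |y - x|
    · rw [hgz y hy, abs_zero]; exact mul_nonneg hb (hw0 _)
    · have : |y - x| - a ∈ Iic (0 : ℝ) := by simp only [mem_Iic]; linarith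
      simp only [hw]
      rw [indicator_of_mem this, mul_one]; exact hgb y
  have hba : Antitone fun t => b * w t := fun s t hst => mul_le_mul_of_nonneg_left (hwa hst) hb
  have hb0 : ∀ t, 0 ≤ b * w t := fun t => mul_nonneg hb (hw0 t)
  refine ⟨integrable_of_radial_bound hC hU hba hb0 (hws.mul_left b) hg.aestronglyMeasurable hbd, ?_⟩
  refine (abs_integral_le_of_radial_bound hC hU hba hb0 (hws.mul_left b)
    hg.aestronglyMeasurable hbd).trans (le_of_eq ?_)
  rw [← tsum_mul_left]
  exact tsum_congr fun k => mul_assoc _ _ _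

/-- The measure `U` smoothed by the test function `φ`. -/
noncomputable def smoothed (U : Measure ℝ) (φ : ℝ → ℝ) (x : ℝ) : ℝ := ∫ y, φ (y - x) ∂U

variable {φ : ℝ → ℝ} {a M : ℝ}

theorem IsStep.eq_zero_of_lt_abs (hφ : IsStep φ a 0 M) {t : ℝ} (ht : a < |t|) : φ t = 0 := by
  rcases abs_cases t with ⟨h, _⟩ | ⟨h, _⟩
  · exact hφ.right _ (by linarith)
  · exact hφ.left _ (by linarith)

theorem IsStep.continuous_sub {f : ℝ → ℝ} {c : ℝ} (hf : IsStep f a c M) (x : ℝ) :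
    Continuous fun y => f (y - x) :=
  hf.uniformContinuous.continuous.comp (continuous_id.sub continuous_const)

theorem integrable_shift (hC : 0 ≤ C) (hU : ∀ x : ℝ, U (Ioc x (x + 1)) ≤ ENNReal.ofReal C)
    (hφ : IsStep φ a 0 M) (x : ℝ) : Integrable (fun y => φ (y - x)) U := by
  obtain ⟨K, hK, h⟩ := exists_integral_le_of_window hC hU a
  exact (h (fun y => φ (y - x)) x M hφ.nonneg (hφ.continuous_sub x) (fun y => hφ.abs_le _)
    (fun y hy => hφ.eq_zero_of_lt_abs hy)).1

theorem exists_bound_integral_abs_shift (hC : 0 ≤ C)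
    (hU : ∀ x : ℝ, U (Ioc x (x + 1)) ≤ ENNReal.ofReal C)
    (hφ : IsStep φ a 0 M) : ∃ B, ∀ x, ∫ y, ‖φ (y - x)‖ ∂U ≤ B := by
  obtain ⟨K, hK, h⟩ := exists_integral_le_of_window hC hU a
  refine ⟨M * K, fun x => (le_abs_self _).trans ?_⟩
  exact (h (fun y => ‖φ (y - x)‖) x M hφ.nonneg (hφ.continuous_sub x).norm
    (fun y => by rw [Real.norm_eq_abs, abs_abs]; exact hφ.abs_le _)
    (fun y hy => by rw [hφ.eq_zero_of_lt_abs hy, norm_zero])).2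

theorem exists_bound_smoothed (hC : 0 ≤ C)
    (hU : ∀ x : ℝ, U (Ioc x (x + 1)) ≤ ENNReal.ofReal C)
    (hφ : IsStep φ a 0 M) : ∃ B, ∀ x, |smoothed U φ x| ≤ B := by
  obtain ⟨B, hB⟩ := exists_bound_integral_abs_shift hC hU hφ
  exact ⟨B, fun x => (norm_integral_le_integral_norm _).trans (hB x)⟩

/-- Two translates of `φ` by less than 1 differ by a uniformly small function supported in a window
of radius `a + 1`. -/
theorem uniformContinuous_smoothed (hC : 0 ≤ C)
    (hU : ∀ x : ℝ, U (Ioc x (x + 1)) ≤ ENNReal.ofReal C)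
    (hφ : IsStep φ a 0 M) : UniformContinuous (smoothed U φ) := by
  obtain ⟨K, hK, h⟩ := exists_integral_le_of_window hC hU (a + 1)
  rw [Metric.uniformContinuous_iff]
  intro ε hε
  have hε' : 0 < ε / (K + 1) := by positivity
  obtain ⟨δ, hδ, hδ'⟩ := Metric.uniformContinuous_iff.1 hφ.uniformContinuous _ hε'
  refine ⟨min δ 1, lt_min hδ one_pos, fun x x' hx => ?_⟩
  have hx1 : |x - x'| < 1 := lt_of_lt_of_le hx (min_le_right _ _)
  rw [Real.dist_eq]
  unfold smoothed
  rw [← integral_sub (integrable_shift hC hU hφ x) (integrable_shift hC hU hφ x')]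
  have hb := (h (fun y => φ (y - x) - φ (y - x')) x (ε / (K + 1)) hε'.le
    ((hφ.continuous_sub x).sub (hφ.continuous_sub x')) (fun y => by
      have hd : dist (y - x) (y - x') < δ := by
        rw [dist_sub_left]; exact lt_of_lt_of_le hx (min_le_left _ _)
      have := hδ' hd
      rw [Real.dist_eq] at this
      exact this.le) (fun y hy => by
      have : |y - x| ≤ |y - x'| + |x - x'| := by
        have := abs_sub (y - x') (x - x'); rwa [sub_sub_sub_cancel_right] at this
      rw [hφ.eq_zero_of_lt_abs (show a < |y - x| by linarith),
        hφ.eq_zero_of_lt_abs (show a < |y - x'| by linarith), sub_self])).2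
  refine hb.trans_lt ?_
  rw [div_mul_eq_mul_div, div_lt_iff₀ (by positivity)]
  nlinarith

variable [SFinite U] {F : Measure ℝ} [IsProbabilityMeasure F]

/-- Fubini applies because the absolute increments, integrated over `F`, have the summable tail of
`F` as a radial majorant. -/
theorem integral_meanIncrement_swap (hC : 0 ≤ C)
    (hU : ∀ x : ℝ, U (Ioc x (x + 1)) ≤ ENNReal.ofReal C)
    (hF : Integrable (fun z : ℝ => z) F) {f : ℝ → ℝ} {c : ℝ} (hf : IsStep f a c M) (x : ℝ) :
    ∫ y, meanIncrement F f (y - x) ∂U = ∫ z, ∫ y, (f (y - x + z) - f (y - x)) ∂U ∂F := by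
  have hM := hf.nonneg
  have hc : Continuous (Function.uncurry fun y z => f (y - x + z) - f (y - x)) :=
    (hf.uniformContinuous.continuous.comp (by fun_prop)).sub
      (hf.uniformContinuous.continuous.comp (by fun_prop))
  unfold meanIncrement
  refine integral_integral_swap ?_
  rw [integrable_prod_iff hc.aestronglyMeasurable]
  constructor
  · refine Eventually.of_forall fun y => Integrable.of_bound (C := 2 * M) ?_
      (Eventually.of_forall fun z => ?_)
    · exact (hc.comp (Continuous.prodMk_right y)).aestronglyMeasurable
    · exact (abs_sub _ _).trans (by
        have h1 := hf.abs_le (y - x + z)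
        have h2 := hf.abs_le (y - x)
        linarith)
  · refine integrable_of_radial_bound hC hU (τ := jumpTail F F M) (jumpTail_antitone hM)
      (jumpTail_nonneg hM) (summable_jumpTail hF hF) (x := x) (a := a)
      hc.aestronglyMeasurable.norm.integral_prod_right' (Eventually.of_forall fun y => ?_)
    rw [abs_of_nonneg (integral_nonneg fun _ => norm_nonneg _)]
    have h := integral_mono_of_nonneg (μ := F)
      (f := fun z => ‖f (y - x + z) - f (y - x)‖) (Eventually.of_forall fun z => norm_nonneg _)
      ((integrable_const (2 * M)).indicator (measurableSet_lt_abs (|y - x| - a)))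
      (Eventually.of_forall fun z => hf.abs_increment_le (y - x) z)
    rw [integral_indicator_const _ (measurableSet_lt_abs _), smul_eq_mul, mul_comm] at h
    refine h.trans ?_
    unfold jumpTail
    exact mul_le_mul_of_nonneg_left (le_add_of_nonneg_left measureReal_nonneg) (by positivity)

/-- Adding a jump `z` to `y` is the same as moving the window from `x` to `x - z`. The flux of `φ`
is thus the harmonicity defect of its smoothing. -/
theorem integral_smoothed_sub (hC : 0 ≤ C)
    (hU : ∀ x : ℝ, U (Ioc x (x + 1)) ≤ ENNReal.ofReal C)
    (hF : Integrable (fun z : ℝ => z) F) (hφ : IsStep φ a 0 M) (x : ℝ) :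
    ∫ y, meanIncrement F φ (y - x) ∂U = ∫ z, smoothed U φ (x - z) ∂F - smoothed U φ x := by
  rw [integral_meanIncrement_swap hC hU hF hφ]
  have h : ∀ z, ∫ y, (φ (y - x + z) - φ (y - x)) ∂U = smoothed U φ (x - z) - smoothed U φ x := by
    intro z
    unfold smoothed
    rw [← integral_sub (integrable_shift hC hU hφ _) (integrable_shift hC hU hφ _)]
    refine integral_congr_ae (Eventually.of_forall fun y => ?_)
    simp only
    rw [← sub_add]
  obtain ⟨B, hB⟩ := exists_bound_smoothed hC hU hφ
  simp_rw [h]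
  rw [integral_sub _ (integrable_const _)]
  · simp
  · exact Integrable.of_bound (C := B) (((uniformContinuous_smoothed hC hU hφ).continuous.comp
      (continuous_const.sub continuous_id)).aestronglyMeasurable)
      (Eventually.of_forall fun z => hB _)

/-- This provides the steps with a nonzero right-hand value, through which `p₀` enters the limit. -/
theorem IsStep.primitive (hφ : IsStep φ a 0 M) (ha : 0 ≤ a) :
    IsStep (fun t => ∫ s in (-a)..t, φ s) a (∫ s in (-a)..a, φ s) (M * (2 * a)) := by
  have hi : ∀ u v, IntervalIntegrable φ volume u v := fun u v =>
    hφ.uniformContinuous.continuous.intervalIntegrable u v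
  have hleft : ∀ t ≤ -a, ∫ s in (-a)..t, φ s = 0 := fun t ht =>
    intervalIntegral.integral_zero_ae (Eventually.of_forall fun s hs => by
      rw [uIoc_of_ge ht] at hs
      exact hφ.left s hs.2)
  have hright : ∀ t, a ≤ t → ∫ s in (-a)..t, φ s = ∫ s in (-a)..a, φ s := fun t ht => by
    rw [← intervalIntegral.integral_add_adjacent_intervals (hi (-a) a) (hi a t),
      intervalIntegral.integral_zero_ae (a := a), add_zero]
    exact Eventually.of_forall fun s hs => by
      rw [uIoc_of_le ht] at hs
      exact hφ.right s hs.1.le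
  have hmid : ∀ t ∈ Icc (-a) a, |∫ s in (-a)..t, φ s| ≤ M * (2 * a) := fun t ht => by
    have := intervalIntegral.norm_integral_le_of_norm_le_const (a := -a) (b := t) (C := M)
      (f := φ) (fun s _ => hφ.abs_le s)
    refine this.trans (mul_le_mul_of_nonneg_left ?_ hφ.nonneg)
    rw [abs_of_nonneg (by linarith [ht.1])]
    linarith [ht.2]
  refine ⟨?_, fun t => ?_, hleft, hright⟩
  · rw [Metric.uniformContinuous_iff]
    intro ε hε
    have hM := hφ.nonneg
    refine ⟨ε / (M + 1), by positivity, fun u v huv => ?_⟩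
    rw [Real.dist_eq, intervalIntegral.integral_interval_sub_left (hi _ _) (hi _ _)]
    have := intervalIntegral.norm_integral_le_of_norm_le_const (a := v) (b := u) (C := M)
      (f := φ) (fun s _ => hφ.abs_le s)
    refine this.trans_lt ?_
    rw [Real.dist_eq, lt_div_iff₀ (by positivity)] at huv
    nlinarith [abs_nonneg (u - v)]
  · rcases le_total t (-a) with h | h
    · rw [hleft t h, abs_zero]; exact mul_nonneg hφ.nonneg (by positivity)
    · rcases le_total t a with h' | h'
      · exact hmid t ⟨h, h'⟩
      · rw [hright t h']; exact hmid a ⟨by linarith, le_rfl⟩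

/-- The increment is the integral of `φ (y - (x - s))` over `s` from 0 to `z`; Fubini then turns the
inner integrals into values of `smoothed`. -/
theorem integral_primitive_increment (hC : 0 ≤ C)
    (hU : ∀ x : ℝ, U (Ioc x (x + 1)) ≤ ENNReal.ofReal C) (hφ : IsStep φ a 0 M) (x z : ℝ) :
    ∫ y, ((∫ s in (-a)..(y - x + z), φ s) - ∫ s in (-a)..(y - x), φ s) ∂U =
      ∫ s in (0 : ℝ)..z, smoothed U φ (x - s) := by
  have hi : ∀ u v, IntervalIntegrable φ volume u v := fun u v =>
    hφ.uniformContinuous.continuous.intervalIntegrable u v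
  have h1 : ∀ y, ((∫ s in (-a)..(y - x + z), φ s) - ∫ s in (-a)..(y - x), φ s) =
      ∫ s in (0 : ℝ)..z, φ (y - (x - s)) := by
    intro y
    rw [intervalIntegral.integral_interval_sub_left (hi _ _) (hi _ _)]
    have := intervalIntegral.integral_comp_add_left (a := 0) (b := z) φ (y - x)
    rw [add_zero] at this
    rw [← this]
    simp_rw [sub_add]
  simp_rw [h1]
  unfold smoothed
  have hc : Continuous (Function.uncurry fun s y => φ (y - (x - s))) :=
    hφ.uniformContinuous.continuous.comp (by fun_prop)
  refine (intervalIntegral_integral_swap (f := fun s y => φ (y - (x - s))) ?_).symm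
  rw [integrable_prod_iff hc.aestronglyMeasurable]
  obtain ⟨B, hB⟩ := exists_bound_integral_abs_shift hC hU hφ
  have hfin : IsFiniteMeasure (volume.restrict (uIoc 0 z)) := ⟨by
    simp [uIoc]⟩
  refine ⟨Eventually.of_forall fun s => integrable_shift hC hU hφ (x - s), ?_⟩
  refine Integrable.of_bound (C := B) hc.aestronglyMeasurable.norm.integral_prod_right'
    (Eventually.of_forall fun s => ?_)
  rw [Real.norm_of_nonneg (integral_nonneg fun _ => norm_nonneg _)]
  exact hB (x - s)

end Smoothing

/-- For a slowly varying function, averaging its primitive increments over `F` amounts to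
multiplication by the mean of `F`. -/
theorem tendsto_integral_primitive_sub {F : Measure ℝ} [IsProbabilityMeasure F]
    (hF : Integrable (fun z : ℝ => z) F) {G : ℝ → ℝ} {B : ℝ} (hB : ∀ x, |G x| ≤ B)
    (hc : Continuous G) (hslow : ∀ s, Tendsto (fun x => G x - G (x - s)) atTop (𝓝 0)) :
    Tendsto (fun x => ∫ z, (∫ s in (0 : ℝ)..z, G (x - s)) ∂F - (∫ z, z ∂F) * G x) atTop (𝓝 0) := by
  have hcx : ∀ x, Continuous fun s => G (x - s) := fun x => hc.comp (continuous_const.sub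
    continuous_id)
  have hcd : ∀ x, Continuous fun s => G (x - s) - G x := fun x => (hcx x).sub continuous_const
  have hbd : ∀ x s, ‖G (x - s) - G x‖ ≤ 2 * B := fun x s =>
    (abs_sub _ _).trans (by linarith [hB x, hB (x - s)])
  have hcz : ∀ {g : ℝ → ℝ}, Continuous g → Continuous fun z => ∫ s in (0 : ℝ)..z, g s :=
    fun hg => intervalIntegral.continuous_primitive (fun u v => hg.intervalIntegrable u v) 0
  -- Two nested dominated convergences: in `s` with constant bound `2 * B`, then in `z` with bound
  -- `2 * B * |z|`, which is where the first moment of `F` is used.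
  have hmain : Tendsto (fun x => ∫ z, (∫ s in (0 : ℝ)..z, (G (x - s) - G x)) ∂F) atTop (𝓝 0) := by
    have := tendsto_integral_filter_of_dominated_convergence (μ := F) (l := (atTop : Filter ℝ))
      (F := fun x z => ∫ s in (0 : ℝ)..z, (G (x - s) - G x)) (f := fun _ => 0)
      (fun z => 2 * B * |z|)
      (Eventually.of_forall fun x => (hcz (hcd x)).aestronglyMeasurable)
      (Eventually.of_forall fun x => Eventually.of_forall fun z => by
        simpa using intervalIntegral.norm_integral_le_of_norm_le_const (a := 0) (b := z)
          (fun s _ => hbd x s))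
      (hF.abs.const_mul _) (Eventually.of_forall fun z => by
        have := intervalIntegral.tendsto_integral_filter_of_dominated_convergence (a := 0) (b := z)
          (μ := volume) (l := (atTop : Filter ℝ))
          (F := fun x s => G (x - s) - G x) (f := fun _ => 0) (fun _ => 2 * B)
          (Eventually.of_forall fun x => (hcd x).aestronglyMeasurable)
          (Eventually.of_forall fun x => Eventually.of_forall fun s _ => hbd x s)
          (by simp) (Eventually.of_forall fun s _ => by
            have := (hslow s).neg
            simpa using this)
        simpa using this)
    simpa using this
  refine hmain.congr fun x => ?_
  rw [← integral_mul_const, ← integral_sub _ (hF.mul_const _)]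
  · refine integral_congr_ae (Eventually.of_forall fun z => ?_)
    simp only
    rw [intervalIntegral.integral_sub ((hcx x).intervalIntegrable _ _) (by simp)]
    simp
  · refine (hF.abs.const_mul B).mono' (hcz (hcx x)).aestronglyMeasurable
      (Eventually.of_forall fun z => ?_)
    simpa using intervalIntegral.norm_integral_le_of_norm_le_const (a := 0) (b := z)
      (f := fun s => G (x - s)) (fun s _ => hB (x - s))

/-! ### Convergence of the smoothed renewal measure -/

section Renewal

variable {U : Measure ℝ} [SFinite U] {C : ℝ} {F : Measure ℝ} [IsProbabilityMeasure F]
  {p₀ : ℝ}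

theorem tendsto_integral_smoothed_sub (hC : 0 ≤ C)
    (hU : ∀ x : ℝ, U (Ioc x (x + 1)) ≤ ENNReal.ofReal C) (hF : Integrable (fun z : ℝ => z) F)
    (hflux : ∀ f : ℝ → ℝ, ∀ a c M : ℝ, IsStep f a c M →
      Tendsto (fun x => ∫ y, meanIncrement F f (y - x) ∂U) atTop (𝓝 (c * p₀)))
    {φ : ℝ → ℝ} {a M : ℝ} (hφ : IsStep φ a 0 M) :
    Tendsto (fun x => ∫ z, smoothed U φ (x - z) ∂F - smoothed U φ x) atTop (𝓝 0) := by
  have := hflux φ a 0 M hφ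
  rw [zero_mul] at this
  exact this.congr fun x => integral_smoothed_sub hC hU hF hφ x

theorem ae_mem_asymptoticPeriods (hC : 0 ≤ C)
    (hU : ∀ x : ℝ, U (Ioc x (x + 1)) ≤ ENNReal.ofReal C) (hF : Integrable (fun z : ℝ => z) F)
    (hflux : ∀ f : ℝ → ℝ, ∀ a c M : ℝ, IsStep f a c M →
      Tendsto (fun x => ∫ y, meanIncrement F f (y - x) ∂U) atTop (𝓝 (c * p₀)))
    {φ : ℝ → ℝ} {a M : ℝ} (hφ : IsStep φ a 0 M) :
    ∀ᵐ z ∂F, z ∈ asymptoticPeriods (smoothed U φ) := by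
  obtain ⟨B, hB⟩ := exists_bound_smoothed hC hU hφ
  have h0 : F F.supportᶜ = 0 := Measure.measure_compl_support
  filter_upwards [compl_mem_ae_iff.2 h0] with z hz
  rw [compl_compl] at hz
  exact tendsto_sub_of_mem_support hB (uniformContinuous_smoothed hC hU hφ)
    (tendsto_integral_smoothed_sub hC hU hF hflux hφ) hz

/-- The smoothed renewal measure converges once it varies slowly. -/
theorem tendsto_smoothed (hC : 0 ≤ C)
    (hU : ∀ x : ℝ, U (Ioc x (x + 1)) ≤ ENNReal.ofReal C) (hF : Integrable (fun z : ℝ => z) F)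
    (hmean : 0 < ∫ z, z ∂F)
    (hflux : ∀ f : ℝ → ℝ, ∀ a c M : ℝ, IsStep f a c M →
      Tendsto (fun x => ∫ y, meanIncrement F f (y - x) ∂U) atTop (𝓝 (c * p₀)))
    {φ : ℝ → ℝ} {a M : ℝ} (hφ : IsStep φ a 0 M) (ha : 0 ≤ a)
    (hslow : ∀ s, s ∈ asymptoticPeriods (smoothed U φ)) :
    Tendsto (smoothed U φ) atTop (𝓝 ((∫ s in (-a)..a, φ s) * p₀ / ∫ z, z ∂F)) := by
  obtain ⟨B, hB⟩ := exists_bound_smoothed hC hU hφ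
  have h1 := hflux _ _ _ _ (hφ.primitive ha)
  have h2 := tendsto_integral_primitive_sub hF hB (uniformContinuous_smoothed hC hU hφ).continuous
    hslow
  have h3 := (h1.sub h2).div_const (∫ z, z ∂F)
  rw [sub_zero] at h3
  refine h3.congr fun x => ?_
  rw [integral_meanIncrement_swap hC hU hF (hφ.primitive ha)]
  simp_rw [integral_primitive_increment hC hU hφ]
  rw [sub_sub_cancel, mul_div_cancel_left₀ _ hmean.ne']

end Renewal

/-! ### From test functions to intervals -/

/-- A continuous approximation of the indicator function of an interval. -/
theorem exists_trapezoid {l r δ : ℝ} (hlr : l ≤ r) (hδ : 0 < δ) :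
    ∃ (φ : ℝ → ℝ) (a : ℝ), 0 ≤ a ∧ IsStep φ a 0 1 ∧ (∀ t, 0 ≤ φ t) ∧ (∀ t, φ t ≤ 1) ∧
      (∀ t ∈ Icc l r, φ t = 1) ∧ (∀ t ∉ Ioo (l - δ) (r + δ), φ t = 0) ∧
      r - l ≤ (∫ s in (-a)..a, φ s) ∧ (∫ s in (-a)..a, φ s) ≤ r - l + 2 * δ := by
  have hsub : Icc l r ⊆ Ioo (l - δ) (r + δ) := fun t ht =>
    ⟨by linarith [ht.1], by linarith [ht.2]⟩
  obtain ⟨φ, h1, h0, hcs, hr⟩ := exists_continuous_one_zero_of_isCompact (isCompact_Icc (a := l)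
    (b := r)) (isOpen_Ioo (a := l - δ) (b := r + δ)).isClosed_compl
    (disjoint_compl_right_iff_subset.2 hsub)
  have h1' : ∀ t ∈ Icc l r, φ t = 1 := fun t ht => h1 ht
  have h0' : ∀ t ∉ Ioo (l - δ) (r + δ), φ t = 0 := fun t ht => h0 ht
  set a := |l| + |r| + δ with ha
  have hal := neg_abs_le l
  have har := le_abs_self r
  have hal0 := abs_nonneg l
  have har0 := abs_nonneg r
  have hstep : IsStep φ a 0 1 := by
    refine ⟨hcs.uniformContinuous_of_continuous φ.continuous, fun t => ?_, fun t ht => ?_,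
      fun t ht => ?_⟩
    · rw [abs_of_nonneg (hr t).1]; exact (hr t).2
    · exact h0' t fun h => by linarith [h.1]
    · exact h0' t fun h => by linarith [h.2]
  have hIeq : ∫ s in (-a)..a, φ s = ∫ s, φ s := by
    refine intervalIntegral.integral_eq_integral_of_support_subset fun t ht => ?_
    have : t ∈ Ioo (l - δ) (r + δ) := by
      by_contra h
      exact ht (h0' t h)
    exact ⟨by linarith [this.1], by linarith [this.2]⟩
  have hφi : Integrable φ := φ.continuous.integrable_of_hasCompactSupport hcs
  refine ⟨φ, a, by positivity, hstep, fun t => (hr t).1, fun t => (hr t).2, h1', h0', ?_, ?_⟩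
  · rw [hIeq]
    have h := integral_mono (μ := volume) (f := (Icc l r).indicator (fun _ => (1 : ℝ)))
      ((integrable_indicator_iff measurableSet_Icc).2 (integrableOn_const (by simp))) hφi
      (fun t => by
        by_cases ht : t ∈ Icc l r
        · rw [indicator_of_mem ht, h1' t ht]
        · rw [indicator_of_notMem ht]; exact (hr t).1)
    rwa [integral_indicator_const _ measurableSet_Icc, smul_eq_mul, mul_one,
      Real.volume_real_Icc_of_le hlr] at h
  · rw [hIeq]
    have h := integral_mono (μ := volume) (g := (Ioo (l - δ) (r + δ)).indicator
      (fun _ => (1 : ℝ))) hφi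
      ((integrable_indicator_iff measurableSet_Ioo).2 (integrableOn_const (by simp)))
      (fun t => by
        by_cases ht : t ∈ Ioo (l - δ) (r + δ)
        · rw [indicator_of_mem ht]; exact (hr t).2
        · rw [indicator_of_notMem ht, h0' t ht])
    rw [integral_indicator_const _ measurableSet_Ioo, smul_eq_mul, mul_one,
      Real.volume_real_Ioo_of_le (by linarith)] at h
    linarith

/-- If the smoothings of `U` converge to multiples of the Lebesgue integral, then so do the
masses of intervals. -/
theorem tendsto_measureReal_Ioc {U : Measure ℝ} {C : ℝ} (hC : 0 ≤ C)
    (hU : ∀ x : ℝ, U (Ioc x (x + 1)) ≤ ENNReal.ofReal C) {ρ : ℝ} (hρ : 0 ≤ ρ)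
    (hlim : ∀ (φ : ℝ → ℝ) (a : ℝ), 0 ≤ a → IsStep φ a 0 1 →
      Tendsto (smoothed U φ) atTop (𝓝 ((∫ s in (-a)..a, φ s) * ρ))) {h : ℝ} (hh : 0 < h) :
    Tendsto (fun x => U.real (Ioc x (x + h))) atTop (𝓝 (h * ρ)) := by
  have hfin : ∀ x, U (Ioc x (x + h)) < ⊤ := fun x =>
    (measure_mono Ioc_subset_Icc_self).trans_lt (measure_Icc_lt_top_of_unit hU _ _)
  have hone : ∀ x, Integrable ((Ioc x (x + h)).indicator (fun _ => (1 : ℝ))) U := fun x =>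
    (integrable_indicator_iff measurableSet_Ioc).2 (integrableOn_const (hfin x).ne)
  have hval : ∀ x, ∫ y, (Ioc x (x + h)).indicator (fun _ => (1 : ℝ)) y ∂U =
      U.real (Ioc x (x + h)) := fun x => by
    rw [integral_indicator_const _ measurableSet_Ioc, smul_eq_mul, mul_one]
  rw [Metric.tendsto_nhds]
  intro ε hε
  -- The bound `h / 2` keeps the inner interval `[δ, h - δ]` nonempty; the other bound makes the
  -- area error `2 * δ * ρ` small.
  set δ := min (h / 2) (ε / (4 * (ρ + 1))) with hδ
  have hδ0 : 0 < δ := by positivity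
  have hδh : δ ≤ h / 2 := min_le_left _ _
  have hδρ : 2 * δ * ρ < ε / 2 + ε / 4 := by
    have : δ * (4 * (ρ + 1)) ≤ ε := by
      rw [← le_div_iff₀ (by positivity)]; exact min_le_right _ _
    nlinarith
  -- The bump `φ` equals 1 on `[0, h]`, while `ψ` vanishes outside `(0, h)`; translated by `x`, they
  -- bound the indicator from above and below.
  obtain ⟨φ, a, ha, hφ, hφ0, hφ1, hφK, hφc, -, hφI⟩ := exists_trapezoid hh.le hδ0
  obtain ⟨ψ, b, hb, hψ, hψ0, hψ1, hψK, hψc, hψI, -⟩ :=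
    exists_trapezoid (show δ ≤ h - δ by linarith) hδ0
  have hup : ∀ᶠ x in atTop, smoothed U φ x < (∫ s in (-a)..a, φ s) * ρ + ε / 4 :=
    (hlim φ a ha hφ).eventually (gt_mem_nhds (by linarith))
  have hlow : ∀ᶠ x in atTop, (∫ s in (-b)..b, ψ s) * ρ - ε / 4 < smoothed U ψ x :=
    (hlim ψ b hb hψ).eventually (lt_mem_nhds (by linarith))
  filter_upwards [hup, hlow] with x hx1 hx2
  have h1 : U.real (Ioc x (x + h)) ≤ smoothed U φ x := by
    rw [← hval]
    refine integral_mono (hone x) (integrable_shift hC hU hφ x) fun y => ?_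
    by_cases hy : y ∈ Ioc x (x + h)
    · rw [indicator_of_mem hy]
      exact (hφK _ ⟨by linarith [hy.1], by linarith [hy.2]⟩).ge
    · rw [indicator_of_notMem hy]; exact hφ0 _
  have h2 : smoothed U ψ x ≤ U.real (Ioc x (x + h)) := by
    rw [← hval]
    refine integral_mono (integrable_shift hC hU hψ x) (hone x) fun y => ?_
    by_cases hy : y ∈ Ioc x (x + h)
    · rw [indicator_of_mem hy]; exact hψ1 _
    · rw [indicator_of_notMem hy]
      refine (hψc _ fun hm => hy ⟨by linarith [hm.1], by linarith [hm.2]⟩).le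
  have h3 := mul_le_mul_of_nonneg_right hφI hρ
  have h4 := mul_le_mul_of_nonneg_right hψI hρ
  rw [Real.dist_eq, abs_lt]
  constructor <;> nlinarith

/-! ### The tent function and integer-valued chains -/

/-- The tent function. -/
noncomputable def tent (t : ℝ) : ℝ := max 0 (1 - |t|)

theorem isStep_tent : IsStep tent 1 0 1 := by
  have hz : ∀ t : ℝ, 1 ≤ |t| → tent t = 0 := fun t ht => max_eq_left (by linarith)
  have hc : Continuous tent := by unfold tent; fun_prop
  refine ⟨HasCompactSupport.uniformContinuous_of_continuous ?_ hc, fun t => ?_, fun t ht => ?_,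
    fun t ht => ?_⟩
  · refine HasCompactSupport.intro (isCompact_Icc (a := -1) (b := 1)) fun t ht => hz t ?_
    by_contra h
    exact ht (abs_le.1 (not_le.1 h).le)
  · rw [abs_of_nonneg (le_max_left _ _)]
    exact max_le zero_le_one (by linarith [abs_nonneg t])
  · exact hz t (by rw [abs_of_nonpos (by linarith)]; linarith)
  · exact hz t (by rw [abs_of_nonneg (by linarith)]; linarith)

theorem integral_tent : ∫ s in (-1 : ℝ)..1, tent s = 1 := by
  have hc : Continuous tent := isStep_tent.uniformContinuous.continuous
  rw [← intervalIntegral.integral_add_adjacent_intervals (b := 0) (hc.intervalIntegrable _ _)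
    (hc.intervalIntegrable _ _)]
  have h1 : ∫ s in (-1 : ℝ)..0, tent s = ∫ s in (-1 : ℝ)..0, (1 + s) := by
    refine intervalIntegral.integral_congr fun s hs => ?_
    rw [uIcc_of_le (by norm_num)] at hs
    simp only [tent]
    rw [abs_of_nonpos hs.2, max_eq_right] <;> linarith [hs.1]
  have h2 : ∫ s in (0 : ℝ)..1, tent s = ∫ s in (0 : ℝ)..1, (1 - s) := by
    refine intervalIntegral.integral_congr fun s hs => ?_
    rw [uIcc_of_le (by norm_num)] at hs
    simp only [tent]
    rw [abs_of_nonneg hs.1, max_eq_right]; linarith [hs.2]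
  rw [h1, h2, intervalIntegral.integral_add (by simp) (by simp),
    intervalIntegral.integral_sub (by simp) (by simp)]
  simp
  norm_num

theorem tent_int (k : ℤ) : tent k = if k = 0 then 1 else 0 := by
  split_ifs with h
  · subst h; simp [tent]
  · refine max_eq_left ?_
    have : (1 : ℝ) ≤ |(k : ℝ)| := by exact_mod_cast Int.one_le_abs h
    linarith

/-- On the integers, a translated tent is linear interpolation between two neighbouring unit masses.
This makes the smoothing of an integer-supported measure affine between consecutive integers. -/
theorem tent_int_sub {θ : ℝ} (h0 : 0 ≤ θ) (h1 : θ ≤ 1) (k : ℤ) :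
    tent (k - θ) = (1 - θ) * tent k + θ * tent ((k - 1 : ℤ)) := by
  rw [tent_int, tent_int]
  rcases lt_trichotomy k 0 with hk | rfl | hk
  · have hk' : (k : ℝ) ≤ -1 := by exact_mod_cast (by omega : k ≤ -1)
    rw [if_neg hk.ne, if_neg (by omega), mul_zero, mul_zero, add_zero]
    exact isStep_tent.left _ (by linarith)
  · simp [tent, abs_of_nonneg h0, h1]
  · rcases (show 1 ≤ k from hk).eq_or_lt with rfl | hk2
    · simp only [tent]
      rw [abs_of_nonneg (by push_cast; linarith)]
      simp [h0]
    · have hk' : (2 : ℝ) ≤ k := by exact_mod_cast hk2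
      rw [if_neg hk.ne', if_neg (by omega), mul_zero, mul_zero, add_zero]
      exact isStep_tent.right _ (by linarith)

section IntegerValued

variable {U : Measure ℝ} {C : ℝ}

theorem smoothed_tent_int (hZint : ∀ᵐ y ∂U, y ∈ range ((↑) : ℤ → ℝ)) (n : ℤ) :
    smoothed U tent n = U.real {(n : ℝ)} := by
  have h : (fun y => tent (y - n)) =ᵐ[U] ({(n : ℝ)} : Set ℝ).indicator (fun _ => (1 : ℝ)) := by
    filter_upwards [hZint] with y ⟨k, hk⟩
    subst hk
    have e : (k : ℝ) - n = ((k - n : ℤ) : ℝ) := by push_cast; ring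
    rw [e, tent_int]
    by_cases hkn : k = n
    · simp [hkn]
    · have : (k : ℝ) ≠ n := by exact_mod_cast hkn
      rw [if_neg (sub_ne_zero.2 hkn), indicator_of_notMem (by simpa using this)]
  unfold smoothed
  rw [integral_congr_ae h, integral_indicator_const _ (measurableSet_singleton _), smul_eq_mul,
    mul_one]

theorem smoothed_tent_eq (hC : 0 ≤ C) (hU : ∀ x : ℝ, U (Ioc x (x + 1)) ≤ ENNReal.ofReal C)
    (hZint : ∀ᵐ y ∂U, y ∈ range ((↑) : ℤ → ℝ)) (x : ℝ) :
    smoothed U tent x = (1 - Int.fract x) * smoothed U tent ⌊x⌋ +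
      Int.fract x * smoothed U tent (⌊x⌋ + 1) := by
  have hi := integrable_shift hC hU isStep_tent
  unfold smoothed
  rw [← integral_const_mul, ← integral_const_mul, ← integral_add ((hi _).const_mul _)
    ((hi _).const_mul _)]
  refine integral_congr_ae ?_
  filter_upwards [hZint] with y ⟨k, hk⟩
  subst hk
  have h := tent_int_sub (Int.fract_nonneg x) (Int.fract_lt_one x).le (k - ⌊x⌋)
  have e1 : (k : ℝ) - x = ((k - ⌊x⌋ : ℤ) : ℝ) - Int.fract x := by
    unfold Int.fract; push_cast; ring
  rw [e1, h]
  push_cast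
  rw [sub_sub]

/-- For a measure on the integers, the smoothing by the tent function is slowly varying as soon
as `1` is an asymptotic period. -/
theorem mem_asymptoticPeriods_smoothed_tent (hC : 0 ≤ C)
    (hU : ∀ x : ℝ, U (Ioc x (x + 1)) ≤ ENNReal.ofReal C)
    (hZint : ∀ᵐ y ∂U, y ∈ range ((↑) : ℤ → ℝ))
    (h1 : (1 : ℝ) ∈ asymptoticPeriods (smoothed U tent)) (s : ℝ) :
    s ∈ asymptoticPeriods (smoothed U tent) := by
  set G := smoothed U tent with hG
  have hfl : Tendsto (fun x : ℝ => ((⌊x⌋ : ℤ) : ℝ)) atTop atTop :=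
    tendsto_intCast_atTop_atTop.comp tendsto_floor_atTop
  have hstep : Tendsto (fun x : ℝ => G (⌊x⌋ + 1) - G ⌊x⌋) atTop (𝓝 0) := by
    have := (mem_asymptoticPeriods.1 h1).comp (tendsto_atTop_add_const_right _ 1 hfl)
    refine this.congr fun x => ?_
    simp [Function.comp]
  have hfloor : Tendsto (fun x : ℝ => G x - G ⌊x⌋) atTop (𝓝 0) := by
    refine squeeze_zero_norm (fun x => ?_) (tendsto_zero_iff_norm_tendsto_zero.1 hstep)
    have e : G x - G ⌊x⌋ = Int.fract x * (G (⌊x⌋ + 1) - G ⌊x⌋) := by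
      rw [hG, smoothed_tent_eq hC hU hZint x]; ring
    rw [e, norm_mul, Real.norm_of_nonneg (Int.fract_nonneg x)]
    exact mul_le_of_le_one_left (norm_nonneg _) (Int.fract_lt_one x).le
  have hsmall : ∀ θ : ℝ, 0 ≤ θ → θ < 1 → θ ∈ asymptoticPeriods G := by
    intro θ h0 hθ1
    have hshift : Tendsto (fun x : ℝ => x - θ) atTop atTop :=
      tendsto_atTop_add_const_right _ (-θ) tendsto_id
    -- Since `0 ≤ θ < 1`, the two floors are equal or consecutive, so the difference is 0 or a
    -- single unit step.
    have hmid : Tendsto (fun x : ℝ => G ⌊x⌋ - G ⌊x - θ⌋) atTop (𝓝 0) := by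
      refine squeeze_zero_norm (fun x => ?_)
        (tendsto_zero_iff_norm_tendsto_zero.1 (hstep.comp hshift))
      simp only [Function.comp]
      have hle : ⌊x - θ⌋ ≤ ⌊x⌋ := Int.floor_le_floor (by linarith)
      have hge : ⌊x⌋ - 1 ≤ ⌊x - θ⌋ := by
        rw [← Int.floor_sub_one]; exact Int.floor_le_floor (by linarith)
      rcases hle.eq_or_lt with h | h
      · rw [h, sub_self, norm_zero]; exact norm_nonneg _
      · have : ⌊x⌋ = ⌊x - θ⌋ + 1 := by omega
        rw [this]; push_cast; exact le_rfl
    have := (hfloor.add hmid).sub (hfloor.comp hshift)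
    rw [add_zero, sub_zero] at this
    refine mem_asymptoticPeriods.2 (this.congr fun x => ?_)
    simp only [Function.comp]; ring
  have hs : s = ⌊s⌋ • (1 : ℝ) + Int.fract s := by simp [Int.floor_add_fract]
  rw [hs]
  exact add_mem (zsmul_mem h1 _) (hsmall _ (Int.fract_nonneg s) (Int.fract_lt_one s))

end IntegerValued

/-! ### The two renewal limits -/

theorem theorem1
    {Ω : Type*} [MeasurableSpace Ω] (μ : Measure Ω) [IsProbabilityMeasure μ]
    (P : Kernel ℝ ℝ) [IsMarkovKernel P] (X : ℕ → Ω → ℝ) (hX : IsMarkovChain μ P X)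
    -- the state space, `ℝ` or `ℤ`; the values of `P` outside it play no role
    (S : Set ℝ) (hS : S = Set.univ ∨ S = Set.range ((↑) : ℤ → ℝ))
    (hXS : ∀ n, ∀ᵐ ω ∂μ, X n ω ∈ S)
    -- the chain is transient with respect to the sets `(k, k + 1]`
    (htrans : ∀ k : ℤ, (⨆ y ∈ S, renewalKernel P y (Set.Ioc (k : ℝ) (k + 1))) < ⊤)
    -- `ξ(x) ⇒ ξ` as `x → ∞` in the state space, where `ξ` has law `F` and positive mean
    (F : ProbabilityMeasure ℝ)
    (hweak : Tendsto (fun x : ℝ => jumpLaw P x) (atTop ⊓ 𝓟 S) (𝓝 F))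
    (hmean : 0 < ∫ z, z ∂(F : Measure ℝ))
    -- an integrable stochastic majorant `η` of the `|ξ(x)|`, with law `ν`
    (ν : Measure ℝ) [IsProbabilityMeasure ν] (hν : Integrable (fun z : ℝ => z) ν)
    (hmaj : ∀ x ∈ S, ∀ t : ℝ,
      (jumpLaw P x : Measure ℝ) {z : ℝ | t < |z|} ≤ ν (Set.Ioi t))
    (hU : (⨆ k : ℤ, renewalMeasure μ X (Set.Ioc (k : ℝ) (k + 1))) < ⊤)
    (p₀ : ℝ) (hp₀ : Tendsto (fun n : ℕ => μ.real {ω | 0 < X n ω}) atTop (𝓝 p₀)) :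
    (¬ IsLattice F → ∀ h : ℝ, 0 < h →
      Tendsto (fun x : ℝ => renewalMeasure μ X (Set.Ioc x (x + h))) atTop
        (𝓝 (ENNReal.ofReal (p₀ * h / ∫ z, z ∂(F : Measure ℝ))))) ∧
    ((∀ n, ∀ᵐ ω ∂μ, X n ω ∈ Set.range ((↑) : ℤ → ℝ)) → HasSpan F 1 →
      Tendsto (fun n : ℕ => renewalMeasure μ X {(n : ℝ)}) atTop
        (𝓝 (ENNReal.ofReal (p₀ / ∫ z, z ∂(F : Measure ℝ))))) := by
  obtain ⟨C, hC, hUC⟩ := measure_Ioc_add_one_le hU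
  have hZ : MeasurableSet (Set.range ((↑) : ℤ → ℝ)) := (countable_range _).measurableSet
  have hSm : MeasurableSet S := by
    rcases hS with rfl | rfl
    exacts [MeasurableSet.univ, hZ]
  have hF : Integrable (fun z : ℝ => z) (F : Measure ℝ) := by
    -- The Bochner integral of a non-integrable function is 0 by convention, so a positive mean
    -- already gives integrability.
    by_contra h
    exact hmean.ne' (integral_undef h)
  have hp₀0 : 0 ≤ p₀ := ge_of_tendsto' hp₀ fun _ => measureReal_nonneg
  have hsf : SFinite (renewalMeasure μ X) := by
    unfold renewalMeasure; infer_instance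
  have hflux : ∀ f : ℝ → ℝ, ∀ a c M : ℝ, IsStep f a c M →
      Tendsto (fun x => ∫ y, meanIncrement (F : Measure ℝ) f (y - x) ∂(renewalMeasure μ X)) atTop
        (𝓝 (c * p₀)) := fun f a c M hf =>
    tendsto_integral_meanIncrement hX hC hUC (ae_renewalMeasure_mem hX hSm hXS) hweak hF hν hmaj
      hp₀ hf
  constructor
  · intro hlat h hh
    have hlim : ∀ (φ : ℝ → ℝ) (a : ℝ), 0 ≤ a → IsStep φ a 0 1 →
        Tendsto (smoothed (renewalMeasure μ X) φ) atTop
          (𝓝 ((∫ s in (-a)..a, φ s) * (p₀ / ∫ z, z ∂(F : Measure ℝ)))) := by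
      intro φ a ha hφ
      rw [← mul_div_assoc]
      exact tendsto_smoothed hC hUC hF hmean hflux hφ ha
        (mem_asymptoticPeriods_of_dense (uniformContinuous_smoothed hC hUC hφ)
          (dense_of_not_isLattice hlat (ae_mem_asymptoticPeriods hC hUC hF hflux hφ)))
    have hreal := ENNReal.tendsto_ofReal
      (tendsto_measureReal_Ioc hC hUC (div_nonneg hp₀0 hmean.le) hlim hh)
    rw [show h * (p₀ / ∫ z, z ∂(F : Measure ℝ)) = p₀ * h / ∫ z, z ∂(F : Measure ℝ) by ring]
      at hreal
    refine hreal.congr fun x => ENNReal.ofReal_toReal ?_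
    exact ((measure_mono Ioc_subset_Icc_self).trans_lt (measure_Icc_lt_top_of_unit hUC _ _)).ne
  · intro hZint hspan
    have hUZ := ae_renewalMeasure_mem hX hZ hZint
    have hG := tendsto_smoothed hC hUC hF hmean hflux isStep_tent zero_le_one
      (mem_asymptoticPeriods_smoothed_tent hC hUC hUZ (one_mem_of_hasSpan_one hspan
        (ae_mem_asymptoticPeriods hC hUC hF hflux isStep_tent)))
    rw [integral_tent, one_mul] at hG
    refine (ENNReal.tendsto_ofReal (hG.comp tendsto_natCast_atTop_atTop)).congr fun n => ?_
    have := smoothed_tent_int hUZ (n : ℤ)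
    simp only [Function.comp]
    rw [Int.cast_natCast] at this
    rw [this]
    refine ENNReal.ofReal_toReal ?_
    have h := measure_Icc_lt_top_of_unit hUC (n : ℝ) n
    rw [Icc_self] at h
    exact h.ne
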